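/- **Conventions.** Let $\mathbf M=\langle M;F\rangle$ be a finite (non-empty) algebra. *Compatible relations and operations.* For $n\ge 0$, an $n$-ary relation $r\subseteq M^n$ is *compatible* with $\mathbf M$ if it is (the underlying set of) a non-empty subalgebra $\mathbf r$ of $\mathbf M^n$. An $n$-ary partial operation $h$ on $M$ is *compatible* if $\operatorname{dom}h$ is a compatible relation and $h:\operatorname{dom}h\to\mathbf M$ is a homomorphism; then $\operatorname{graph}h\subseteq M^{n+1}$ is a compatible relation. An *alter ego* $\mathbb M=\langle M;H,R,\mathcal T\rangle$ consists of a set $H$ of compatible partial operations, a set $R$ of compatible relations and the discrete topology on $M$; the members of $H$ and $R$ serve as their own symbols. A compatible relation $r$ is *hom-minimal* if every homomorphism $\mathbf r\to\mathbf M$ is a coordinate projection. The *enriched partial clone* of $\mathbb M$ is the smallest set of partial operations on $M$ that contains $H$ and the projections and is closed under composition with maximum, non-empty domain (nullary operations are allowed). $\mathbb M$ is *operationally rich* at $r\subseteq M^n$ if every compatible partial operation with domain $r$ has an extension in the enriched partial clone of $\mathbb M$. *Logic.* An atomic formula is true at a tuple only if all its terms are defined there. A *conjunct-atomic formula* is a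 finite (possibly empty) conjunction of atomic formulas; a non-empty relation on $M$ is *conjunct-atomic definable* from $\mathbb M$ if it is the solution set in $\mathbb M$ of such a formula in the language of $\mathbb M$. A *uH-sentence* is $\forall\vec v\,[\alpha_1\wedge\dots\wedge\alpha_\nu\to\gamma]$, $\nu\ge0$, with each $\alpha_i$ atomic and $\gamma$ atomic or $\bot$. It is *pure* if each $\alpha_i$ is of the form $r(v_{i_1},\dots,v_{i_n})$ or $h(v_{i_1},\dots,v_{i_n})=v_{i_0}$, and $\gamma$ is of the form $r(v_{i_1},\dots,v_{i_n})$, or $h(v_{i_1},\dots,v_{i_n})=h(v_{i_1},\dots,v_{i_n})$, or $u=v$, or $\bot$, where all arguments are variables. A *pure uH-basis* of $\mathbb M$ is a set of pure uH-sentences true in $\mathbb M$ that logically implies every uH-sentence true in $\mathbb M$ (over all structures with partial operations, the empty structure included). *Dualities.* Let $\mathscr A$ be the class of non-empty algebras that embed into a power of $\mathbf M$, and let $\mathscr X$ be the class of isomorphic copies of topologically closed substructures of non-zero powers of $\mathbb M$, where a substructure is a subset closed under the partial operations of $H$ wherever they are defined, with all relations, operations and domains restricted. For $\mathbf A\in\mathscr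 A$, let $D(\mathbf A)\le\mathbb M^A$ consist of the homomorphisms $\mathbf A\to\mathbf M$; for $\mathbb X\in\mathscr X$, let $E(\mathbb X)\le\mathbf M^X$ consist of the continuous structure-preserving maps $\mathbb X\to\mathbb M$. Then $\mathbb M$ *fully dualises* $\mathbf M$ [*at the finite level*] if the evaluation maps $\mathbf A\to ED(\mathbf A)$ and $\mathbb X\to DE(\mathbb X)$ are isomorphisms for all [finite] $\mathbf A\in\mathscr A$ and all [finite] $\mathbb X\in\mathscr X$. $\mathbb M$ is *standard* if $\mathscr X$ is exactly the class of all Boolean structures of signature $(H,R)$ (compact, Hausdorff, totally disconnected, possibly empty, with closed relations and with continuous partial operations on closed domains) that satisfy every uH-sentence true in $\mathbb M$. **Theorem.** Let $\mathbb M_1=\langle M;H_1,R_1,\mathcal T\rangle$ and $\mathbb M_2=\langle M;H_2,R_2,\mathcal T\rangle$ be alter egos of $\mathbf M$. Assume: * (hm) every hom-minimal relation is conjunct-atomic definable from $\mathbb M_2$; * (op) $\mathbb M_2$ is operationally rich at each $r\in R_2$ and at $\operatorname{dom}h$ for each $h\in H_2$. For each compatible relation $r$, say $n$-ary, fix an enumeration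 $f_1,\dots,f_m$ of the homomorphisms $\mathbf r\to\mathbf M$, put $\widehat r=\{(\vec a,f_1(\vec a),\dots,f_m(\vec a)):\vec a\in r\}$, and fix a conjunct-atomic formula $\widehat\beta_r(\vec v,\vec w)$ in the language of $\mathbb M_2$ that defines $\widehat r$ in $\mathbb M_2$ (it exists by (hm), because $\widehat r$ is hom-minimal). Let $\Sigma_1$ be a pure uH-basis of $\mathbb M_1$. For $\phi=\forall\vec v\,[\alpha_1\wedge\dots\wedge\alpha_\nu\to\gamma]$ in $\Sigma_1$, the *translated premise* of $\phi$ is the conjunction $\alpha_1^\natural(\vec v,\vec w_1)\wedge\dots\wedge\alpha_\nu^\natural(\vec v,\vec w_\nu)$ with pairwise disjoint tuples $\vec w_1,\dots,\vec w_\nu$ of new variables, where $\alpha_i^\natural$ is $\widehat\beta_r(v_{i_1},\dots,v_{i_n},\vec w_i)$ if $\alpha_i$ is $r(v_{i_1},\dots,v_{i_n})$, and $\widehat\beta_{\operatorname{graph}h}(v_{i_1},\dots,v_{i_n},v_{i_0},\vec w_i)$ if $\alpha_i$ is $h(v_{i_1},\dots,v_{i_n})=v_{i_0}$. Assume: * (ax)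 for each $\phi\in\Sigma_1$ whose conclusion is not in the language of $\mathbb M_2$ (its relation or operation symbol is not in $R_2$, respectively $H_2$), $\mathbb M_2$ is operationally rich at the relation on $M$, in the variables $\vec v,\vec w_1,\dots,\vec w_\nu$, defined in $\mathbb M_2$ by the translated premise of $\phi$. Then: 1. if $\mathbb M_1$ fully dualises $\mathbf M$ at the finite level, then so does $\mathbb M_2$; 2. if $\mathbb M_1$ is standard and fully dualises $\mathbf M$, then $\mathbb M_2$ is standard and fully dualises $\mathbf M$. -/

import Mathlib

open scoped FirstOrder

universe u v w

namespace NatDual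

/-! ### Partial topological structures -/

/-- A signature `(H, R)` of finitary partial operation symbols and relation symbols. -/
structure Sig where
  Op : Type u
  opArity : Op → ℕ
  Rel : Type u
  relArity : Rel → ℕ

/-- A structure of signature `S`. The underlying set may be empty, the partial operations may
have empty domains, and there is no topology yet. -/
structure PStruct (S : Sig.{u}) where
  carrier : Type u
  op : ∀ h : S.Op, (Fin (S.opArity h) → carrier) →. carrier
  rel : ∀ r : S.Rel, Set (Fin (S.relArity r) → carrier)

/-- A topological structure of signature `S` (no compatibility with the topology assumed). -/
structure TopStruct (S : Sig.{u}) extends PStruct S where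
  top : TopologicalSpace carrier

instance (S : Sig.{u}) : CoeSort (PStruct S) (Type u) := ⟨fun X => X.carrier⟩
instance (S : Sig.{u}) : CoeSort (TopStruct S) (Type u) := ⟨fun X => X.carrier⟩
instance {S : Sig.{u}} (X : TopStruct S) : TopologicalSpace X.carrier := X.top

/-- A family of partially defined elements, seen as a partially defined family: it is defined
when all of its members are. -/
def piPart {ι X : Type*} (p : ι → Part X) : Part (ι → X) :=
  ⟨∀ i, (p i).Dom, fun hp i => (p i).get (hp i)⟩

namespace TopStruct

variable {S : Sig.{u}}

/-- The power `Y ^ I`: operations (with their domains) and relations are coordinatewise. -/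
def pow (Y : TopStruct S) (I : Type u) : TopStruct S where
  carrier := I → Y
  op h x := piPart fun i => Y.op h fun j => x j i
  rel r := {x | ∀ i, (fun j => x j i) ∈ Y.rel r}
  top := inferInstance

/-- The set `U` is closed under all the partial operations of `Y`, wherever they are defined. -/
def OpClosed (Y : TopStruct S) (U : Set Y) : Prop :=
  ∀ (h : S.Op) (x : Fin (S.opArity h) → Y), (∀ j, x j ∈ U) → ∀ y ∈ Y.op h x, y ∈ U

/-- The substructure of `Y` on `U`: relations, domains and operations are restricted to `U`. -/
def sub (Y : TopStruct S) (U : Set Y) (hU : Y.OpClosed U) : TopStruct S where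
  carrier := U
  op h x := ⟨(Y.op h fun j => (x j : Y)).Dom,
    fun hd => ⟨(Y.op h fun j => (x j : Y)).get hd,
      hU h _ (fun j => (x j).2) _ (Part.get_mem hd)⟩⟩
  rel r := {x | (fun j => (x j : Y)) ∈ Y.rel r}
  top := inferInstance

/-- Morphisms: continuous maps that preserve the partial operations and the relations. -/
structure IsMorphism (X Y : TopStruct S) (f : X → Y) : Prop where
  continuous : Continuous f
  map_op : ∀ (h : S.Op) (x : Fin (S.opArity h) → X), ∀ y ∈ X.op h x, f y ∈ Y.op h (f ∘ x)
  map_rel : ∀ (r : S.Rel), ∀ x ∈ X.rel r, f ∘ x ∈ Y.rel r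

/-- Isomorphisms: homeomorphisms under which domains, operations and relations correspond. -/
structure IsIsomorphism (X Y : TopStruct S) (f : X → Y) : Prop where
  homeo : IsHomeomorph f
  map_op : ∀ (h : S.Op) (x : Fin (S.opArity h) → X), Y.op h (f ∘ x) = (X.op h x).map f
  map_rel : ∀ (r : S.Rel) (x : Fin (S.relArity r) → X), f ∘ x ∈ Y.rel r ↔ x ∈ X.rel r

/-- Boolean structures: the topology is Boolean, relations and domains of partial operations are
closed, and partial operations are continuous on their domains. The empty structure is allowed. -/
structure IsBoolean (X : TopStruct S) : Prop where
  compact : CompactSpace X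
  hausdorff : T2Space X
  totallyDisconnected : TotallyDisconnectedSpace X
  isClosed_rel : ∀ r : S.Rel, IsClosed (X.rel r)
  isClosed_dom : ∀ h : S.Op, IsClosed (X.op h).Dom
  continuous_op : ∀ h : S.Op, Continuous fun x : (X.op h).Dom => (X.op h).fn x.1 x.2

end TopStruct

/-! ### Atomic formulas and universal Horn sentences -/

/-- Terms in the variables `v₀, …, vₙ₋₁`. -/
inductive Term (S : Sig.{u}) (n : ℕ) : Type u
  | var (i : Fin n) : Term S n
  | app (h : S.Op) (t : Fin (S.opArity h) → Term S n) : Term S n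

/-- Atomic formulas in the variables `v₀, …, vₙ₋₁`. -/
inductive Atom (S : Sig.{u}) (n : ℕ) : Type u
  | rel (r : S.Rel) (t : Fin (S.relArity r) → Term S n) : Atom S n
  | eq (s t : Term S n) : Atom S n

variable {S : Sig.{u}}

/-- Renaming of variables. -/
def Term.rename {n k : ℕ} (ρ : Fin n → Fin k) : Term S n → Term S k
  | .var i => .var (ρ i)
  | .app h t => .app h fun j => (t j).rename ρ

/-- Renaming of variables. -/
def Atom.rename {n k : ℕ} (ρ : Fin n → Fin k) : Atom S n → Atom S k
  | .rel r t => .rel r fun j => (t j).rename ρ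
  | .eq s t => .eq (s.rename ρ) (t.rename ρ)

/-- The value of a term; it is defined when all its subterms are. -/
def Term.eval (X : PStruct S) {n : ℕ} (a : Fin n → X) : Term S n → Part X
  | .var i => Part.some (a i)
  | .app h t => (piPart fun j => (t j).eval X a).bind (X.op h)

/-- Truth of an atomic formula; all terms in it must be defined. In particular `t = t` says that
`t` is defined. -/
def Atom.Holds (X : PStruct S) {n : ℕ} (a : Fin n → X) : Atom S n → Prop
  | .rel r t => ∃ b ∈ piPart (fun j => (t j).eval X a), b ∈ X.rel r
  | .eq s t => ∃ b, b ∈ s.eval X a ∧ b ∈ t.eval X a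

/-- Conjunct-atomic formulas (finite, possibly empty, conjunctions of atomic formulas) in the
variables `v₀, …, vₙ₋₁`. -/
abbrev ConjAtomic (S : Sig.{u}) (n : ℕ) : Type u := List (Atom S n)

/-- The relation defined in `X` by a conjunct-atomic formula. -/
def ConjAtomic.solutions {n : ℕ} (Ψ : ConjAtomic S n) (X : PStruct S) : Set (Fin n → X) :=
  {a | ∀ ψ ∈ Ψ, ψ.Holds X a}

/-- The universal Horn sentence `∀ v₀ … vₙ₋₁ (premise → conclusion)`. The conclusion is an atomic
formula, or `⊥`, which is coded as `none`. -/
structure UHSentence (S : Sig.{u}) where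
  n : ℕ
  premise : ConjAtomic S n
  conclusion : Option (Atom S n)

/-- Truth of a universal Horn sentence in a structure. -/
def UHSentence.Holds (σ : UHSentence S) (X : PStruct S) : Prop :=
  ∀ a ∈ σ.premise.solutions X, ∃ γ ∈ σ.conclusion, γ.Holds X a

/-- Hypothetically pure formulas: `r(v_{i₁}, …)`, or `h(v_{i₁}, …) = v_{i₀}`. -/
inductive HypPure (S : Sig.{u}) (n : ℕ) : Type u
  | rel (r : S.Rel) (x : Fin (S.relArity r) → Fin n) : HypPure S n
  | graph (h : S.Op) (x : Fin (S.opArity h) → Fin n) (y : Fin n) : HypPure S n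

/-- Conclusively pure formulas: `r(v_{i₁}, …)`, or `h(v_{i₁}, …) = h(v_{i₁}, …)`, or `vᵢ = vⱼ`,
or `⊥`. -/
inductive ConclPure (S : Sig.{u}) (n : ℕ) : Type u
  | rel (r : S.Rel) (x : Fin (S.relArity r) → Fin n) : ConclPure S n
  | dom (h : S.Op) (x : Fin (S.opArity h) → Fin n) : ConclPure S n
  | eq (i j : Fin n) : ConclPure S n
  | bot : ConclPure S n

/-- The atomic formula denoted by a hypothetically pure formula. -/
def HypPure.toAtom {n : ℕ} : HypPure S n → Atom S n
  | .rel r x => .rel r fun j => .var (x j)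
  | .graph h x y => .eq (.app h fun j => .var (x j)) (.var y)

/-- The atomic formula, or `⊥`, denoted by a conclusively pure formula. -/
def ConclPure.toConclusion {n : ℕ} : ConclPure S n → Option (Atom S n)
  | .rel r x => some (.rel r fun j => .var (x j))
  | .dom h x => some (.eq (.app h fun j => .var (x j)) (.app h fun j => .var (x j)))
  | .eq i j => some (.eq (.var i) (.var j))
  | .bot => none

/-- Pure universal Horn sentences, with a premise of `len` hypothetically pure formulas. -/
structure PureUH (S : Sig.{u}) where
  n : ℕ
  len : ℕ
  premise : Fin len → HypPure S n
  conclusion : ConclPure S n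

/-- A pure universal Horn sentence as a universal Horn sentence. -/
def PureUH.toUH (φ : PureUH S) : UHSentence S where
  n := φ.n
  premise := List.ofFn fun i => (φ.premise i).toAtom
  conclusion := φ.conclusion.toConclusion

/-- `Γ` is a basis for the universal Horn theory of `Y`: its members hold in `Y`, and every
universal Horn sentence that holds in `Y` is a logical consequence of `Γ`. -/
def IsPureBasis (Γ : Set (PureUH S)) (Y : PStruct S) : Prop :=
  (∀ φ ∈ Γ, φ.toUH.Holds Y) ∧
  ∀ σ : UHSentence S, σ.Holds Y →
    ∀ X : PStruct S, (∀ φ ∈ Γ, φ.toUH.Holds X) → σ.Holds X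

/-! ### Compatible relations and partial operations, alter egos -/

section Algebra

/-- The power `N ^ ι` of an algebra. -/
instance piStructure (L : FirstOrder.Language.{v, w}) (N : Type*) [L.Structure N] (ι : Type*) :
    L.Structure (ι → N) where
  funMap f x i := FirstOrder.Language.Structure.funMap f fun k => x k i
  RelMap r x := ∀ i, FirstOrder.Language.Structure.RelMap r fun k => x k i

variable (L : FirstOrder.Language.{v, w}) (M : Type u) [L.Structure M]

/-- The `n`-ary relations compatible with `M`: the (non-empty) subalgebras of `M ^ n`. -/
structure CompatRel (n : ℕ) where
  alg : L.Substructure (Fin n → M)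
  nonempty : (alg : Set (Fin n → M)).Nonempty

/-- The `n`-ary partial operations compatible with `M`: homomorphisms to `M` from a compatible
relation, which is the domain. -/
structure CompatOp (n : ℕ) where
  dom : CompatRel L M n
  map : dom.alg →[L] M

variable {L M}

/-- The partial operation on the set `M` that underlies a compatible partial operation. -/
def CompatOp.toPFun {n : ℕ} (h : CompatOp L M n) : (Fin n → M) →. M :=
  fun a => ⟨a ∈ h.dom.alg, fun ha => h.map ⟨a, ha⟩⟩

/-- The graph of a compatible partial operation, as a compatible relation. -/
def CompatOp.graph {n : ℕ} (h : CompatOp L M n) : CompatRel L M (n + 1) where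
  alg :=
    { carrier := {b | ∃ a : h.dom.alg, b = Fin.snoc (α := fun _ => M) a.1 (h.map a)}
      fun_mem := by
        intro k f x hx
        choose a ha using hx
        refine ⟨FirstOrder.Language.Structure.funMap f a, ?_⟩
        rw [FirstOrder.Language.Hom.map_fun]
        funext j
        refine Fin.lastCases ?_ (fun i => ?_) j
        · simp only [Fin.snoc_last]
          change FirstOrder.Language.Structure.funMap f (fun k => x k (Fin.last n)) = _
          congr 1
          funext k
          simp [ha k]
        · simp only [Fin.snoc_castSucc]
          change FirstOrder.Language.Structure.funMap f (fun k => x k i.castSucc) =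
            FirstOrder.Language.Structure.funMap f (fun k => (a k).1 i)
          congr 1
          funext k
          simp [ha k] }
  nonempty := by
    obtain ⟨a, ha⟩ := h.dom.nonempty
    exact ⟨_, ⟨a, ha⟩, rfl⟩

variable (L M)

/-- An alter ego of `M`: a set `H` of compatible partial operations and a set `R` of compatible
relations. The topology is always the discrete one, see `AlterEgo.str`. -/
structure AlterEgo where
  H : Set (Σ n, CompatOp L M n)
  R : Set (Σ n, CompatRel L M n)

variable {L M}

namespace AlterEgo

/-- The signature of an alter ego: its partial operations and relations name themselves. -/
abbrev sig (𝕄 : AlterEgo L M) : Sig.{u} where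
  Op := 𝕄.H
  opArity h := h.1.1
  Rel := 𝕄.R
  relArity r := r.1.1

/-- The alter ego as a discrete topological structure on the set `M`. -/
def str (𝕄 : AlterEgo L M) : TopStruct 𝕄.sig where
  carrier := M
  op h := h.1.2.toPFun
  rel r := (r.1.2.alg : Set (Fin r.1.1 → M))
  top := ⊥

/-- The enriched partial clone of `𝕄`: generated from the partial operations of `𝕄` and the
projections by composition with maximum, non-empty domain. -/
inductive Clo (𝕄 : AlterEgo L M) : ∀ n : ℕ, ((Fin n → M) →. M) → Prop
  | basic {n : ℕ} (h : CompatOp L M n) (hh : ⟨n, h⟩ ∈ 𝕄.H) : Clo 𝕄 n h.toPFun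
  | proj {n : ℕ} (i : Fin n) : Clo 𝕄 n fun a => Part.some (a i)
  | comp {k n : ℕ} (f : (Fin k → M) →. M) (g : Fin k → ((Fin n → M) →. M))
      (hf : Clo 𝕄 k f) (hg : ∀ j, Clo 𝕄 n (g j))
      (hne : ∃ a, ((piPart fun j => g j a).bind f).Dom) :
      Clo 𝕄 n fun a => (piPart fun j => g j a).bind f

/-- The non-empty `n`-ary relation `r` on `M` is conjunct-atomic definable from `𝕄`. -/
def CADefinable (𝕄 : AlterEgo L M) {n : ℕ} (r : Set (Fin n → M)) : Prop :=
  r.Nonempty ∧ ∃ Ψ : ConjAtomic 𝕄.sig n, r = Ψ.solutions 𝕄.str.toPStruct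

/-- `𝕄` is operationally rich at `r`: every compatible partial operation with domain `r` has an
extension in the enriched partial clone of `𝕄`. -/
def OpRich (𝕄 : AlterEgo L M) {n : ℕ} (r : Set (Fin n → M)) : Prop :=
  ∀ h : CompatOp L M n, (h.dom.alg : Set (Fin n → M)) = r →
    ∃ g, 𝕄.Clo n g ∧ ∀ a : h.dom.alg, h.map a ∈ g a.1

end AlterEgo

/-- A compatible relation `r` is hom-minimal if every homomorphism `r → M` is a projection. -/
def CompatRel.HomMinimal {n : ℕ} (r : CompatRel L M n) : Prop :=
  ∀ f : r.alg →[L] M, ∃ i : Fin n, ∀ a : r.alg, f a = a.1 i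

/-- Every hom-minimal relation on `M` is conjunct-atomic definable from `𝕄`. -/
def AlterEgo.CondHM (𝕄 : AlterEgo L M) : Prop :=
  ∀ (n : ℕ) (r : CompatRel L M n), r.HomMinimal → 𝕄.CADefinable (r.alg : Set (Fin n → M))

/-- `𝕄` is operationally rich at its own relations and at the domains of its own partial
operations. -/
def AlterEgo.CondOP (𝕄 : AlterEgo L M) : Prop :=
  (∀ (n : ℕ) (r : CompatRel L M n), ⟨n, r⟩ ∈ 𝕄.R → 𝕄.OpRich (r.alg : Set (Fin n → M))) ∧
  (∀ (n : ℕ) (h : CompatOp L M n), ⟨n, h⟩ ∈ 𝕄.H → 𝕄.OpRich (h.dom.alg : Set (Fin n → M)))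

/-! ### The translation of premises -/

/-- The relation `r̂ = {(a, f₁(a), …, fₘ(a)) | a ∈ r}`, for an enumeration `f₁, …, fₘ` of the
homomorphisms from `r` to `M`. -/
def CompatRel.hat {n m : ℕ} (r : CompatRel L M n) (f : Fin m ≃ (r.alg →[L] M)) :
    Set (Fin (n + m) → M) :=
  {b | ∃ a : r.alg, b = Fin.append a.1 fun j => f j a}

theorem CompatRel.funMap_append {n m : ℕ} (r : CompatRel L M n) (f : Fin m → (r.alg →[L] M)) {k : ℕ}
    (F : L.Functions k) (a : Fin k → r.alg) :
    FirstOrder.Language.Structure.funMap F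
        (fun i => (Fin.append (a i).1 fun j => f j (a i) : Fin (n + m) → M)) =
      Fin.append (FirstOrder.Language.Structure.funMap F a).1
        fun j => f j (FirstOrder.Language.Structure.funMap F a) := by
  funext j
  refine Fin.addCases (fun i => ?_) (fun i => ?_) j
  · simp only [Fin.append_left]
    change FirstOrder.Language.Structure.funMap F (fun k => _) =
            FirstOrder.Language.Structure.funMap F (fun k => (a k).1 i)
    congr 1
    funext k
    simp
  · simp only [Fin.append_right, FirstOrder.Language.Hom.map_fun]
    change FirstOrder.Language.Structure.funMap F (fun k => _) = _
    congr 1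
    funext k
    simp

/-- The relation `r̂`, as a compatible relation. -/
def CompatRel.hatRel {n m : ℕ} (r : CompatRel L M n) (f : Fin m ≃ (r.alg →[L] M)) :
    CompatRel L M (n + m) where
  alg := { carrier := r.hat f
           fun_mem := by
            intro k F x hx
            choose a ha using hx
            obtain rfl : x = fun i => _ := funext ha
            exact ⟨_, CompatRel.funMap_append r f F a⟩ }
  nonempty := by
    obtain ⟨a, ha⟩ := r.nonempty
    exact ⟨_, ⟨a, ha⟩, rfl⟩

/-- The relation `r̂` is hom-minimal. -/
theorem CompatRel.hatRel_homMinimal [L.IsAlgebraic] {n m : ℕ} (r : CompatRel L M n)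
    (f : Fin m ≃ (r.alg →[L] M)) :
    (r.hatRel f).HomMinimal := by
  intro g
  let q : r.alg →[L] M :=
    { toFun := fun a => g ⟨Fin.append a.1 fun j => f j a, a, rfl⟩
      map_fun' := by
        intro k F a
        refine Eq.trans ?_ (g.map_fun F _)
        congr 1
        apply Subtype.ext
        exact (CompatRel.funMap_append r f F a).symm
      map_rel' := by
        intro k R
        exact isEmptyElim R }
  refine ⟨Fin.natAdd n (f.symm q), ?_⟩
  rintro ⟨_, a, rfl⟩
  have : f (f.symm q) a = q a := by simp
  simp only [Fin.append_right]
  rw [this]; rfl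

/-- A choice, for every compatible relation `r`, of an enumeration of the homomorphisms from `r`
to `M` and of a conjunct-atomic formula in the language of `𝕄` that defines `r̂` in `𝕄`. -/
structure HatChoice (𝕄 : AlterEgo L M) where
  m : ∀ {n : ℕ}, CompatRel L M n → ℕ
  enum : ∀ {n : ℕ} (r : CompatRel L M n), Fin (m r) ≃ (r.alg →[L] M)
  formula : ∀ {n : ℕ} (r : CompatRel L M n), ConjAtomic 𝕄.sig (n + m r)
  defines : ∀ {n : ℕ} (r : CompatRel L M n),
    (formula r).solutions 𝕄.str.toPStruct = r.hat (enum r)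

/-- The choices in `HatChoice` can be made whenever hom-minimal relations are conjunct-atomic
definable from `𝕄`. -/
theorem HatChoice.nonempty_of_condHM [L.IsAlgebraic] [Finite M] (𝕄 : AlterEgo L M)
    (h : 𝕄.CondHM) : Nonempty (HatChoice 𝕄) := by
  classical
  have fin : ∀ {n} (r : CompatRel L M n), Finite (r.alg →[L] M) := fun r =>
    Finite.of_injective (fun g : r.alg →[L] M => (g : r.alg → M)) DFunLike.coe_injective
  have e : ∀ {n} (r : CompatRel L M n), Nonempty (Σ m, Fin m ≃ (r.alg →[L] M)) := fun r => by
    have := fin r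
    obtain ⟨m, ⟨e⟩⟩ := Finite.exists_equiv_fin (r.alg →[L] M)
    exact ⟨m, e.symm⟩
  let E := fun {n} (r : CompatRel L M n) => Classical.choice (e r)
  have hb : ∀ {n} (r : CompatRel L M n), ∃ Ψ : ConjAtomic 𝕄.sig (n + (E r).1),
      Ψ.solutions 𝕄.str.toPStruct = r.hat (E r).2 := fun r => by
    obtain ⟨_, Ψ, hΨ⟩ := h _ _ (r.hatRel_homMinimal (E r).2)
    exact ⟨Ψ, hΨ.symm⟩
  exact ⟨⟨fun r => (E r).1, fun r => (E r).2,
    fun r => Classical.choose (hb r), fun r => Classical.choose_spec (hb r)⟩⟩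

variable {𝕄₁ 𝕄₂ : AlterEgo L M}

/-- The arity of the compatible relation in a hypothetically pure formula. -/
def HypPure.arity {n : ℕ} : HypPure 𝕄₁.sig n → ℕ
  | .rel r _ => r.1.1
  | .graph h _ _ => h.1.1 + 1

/-- The compatible relation in a hypothetically pure formula: `r` for `r(x)`, and the graph of
`h` for `h(x) = y`. -/
def HypPure.compatRel {n : ℕ} : (α : HypPure 𝕄₁.sig n) → CompatRel L M α.arity
  | .rel r _ => r.1.2
  | .graph h _ _ => h.1.2.graph

/-- The variables to which `HypPure.compatRel` is applied. -/
def HypPure.vars {n : ℕ} : (α : HypPure 𝕄₁.sig n) → Fin α.arity → Fin n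
  | .rel _ x => x
  | .graph _ x y => Fin.snoc (α := fun _ => Fin n) x y

/-- The number of variables of the translated sentence: the original variables, followed by one
block of new variables for each formula in the premise. -/
abbrev PureUH.natArity (φ : PureUH 𝕄₁.sig) (τ : HatChoice 𝕄₂) : ℕ :=
  φ.n + ∑ i, τ.m (φ.premise i).compatRel

/-- The translated premise: each formula `r(x)` (or `h(x) = y`) in the premise is replaced by the
chosen conjunct-atomic formula for `r̂` (or for the hat of the graph of `h`) in the language of
`𝕄₂`, applied to the same variables followed by a block of new variables of its own. -/
def PureUH.natPremise (φ : PureUH 𝕄₁.sig) (τ : HatChoice 𝕄₂) :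
    ConjAtomic 𝕄₂.sig (φ.natArity τ) :=
  (List.finRange φ.len).flatMap fun i =>
    (τ.formula (φ.premise i).compatRel).map <| Atom.rename <|
      Fin.addCases
        (fun j => Fin.castAdd _ ((φ.premise i).vars j))
        (fun j => Fin.natAdd φ.n (finSigmaFinEquiv ⟨i, j⟩))

/-- The conclusion of a pure sentence in the language of `𝕄₁` is in the language of `𝕄₂`: the
symbol that occurs in it (if there is one) belongs to `𝕄₂`. -/
def ConclPure.InLanguageOf {𝕄₁ : AlterEgo L M} (𝕄₂ : AlterEgo L M) {n : ℕ} :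
    ConclPure 𝕄₁.sig n → Prop
  | .rel r _ => r.1 ∈ 𝕄₂.R
  | .dom h _ => h.1 ∈ 𝕄₂.H
  | .eq _ _ => True
  | .bot => True

/-- With respect to the set `Γ` of pure sentences in the language of `𝕄₁` and the choice `τ`, the
alter ego `𝕄₂` is operationally rich at the relation defined by the translated premise of each
sentence in `Γ` whose conclusion is not in the language of `𝕄₂`. -/
def CondAX {𝕄₁ 𝕄₂ : AlterEgo L M} (Γ : Set (PureUH 𝕄₁.sig)) (τ : HatChoice 𝕄₂) : Prop :=
  ∀ φ ∈ Γ, ¬ φ.conclusion.InLanguageOf 𝕄₂ →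
    𝕄₂.OpRich ((φ.natPremise τ).solutions 𝕄₂.str.toPStruct)

/-! ### Dual classes, hom-functors, dualities -/

/-- The class of all isomorphic copies of topologically closed substructures of non-zero powers
of `𝕄`. -/
def AlterEgo.InDualClass (𝕄 : AlterEgo L M) (X : TopStruct 𝕄.sig) : Prop :=
  ∃ (I : Type u) (_ : Nonempty I) (U : Set (𝕄.str.pow I)) (hU : (𝕄.str.pow I).OpClosed U),
    IsClosed U ∧ ∃ f, X.IsIsomorphism ((𝕄.str.pow I).sub U hU) f

/-- The class of all Boolean models of the universal Horn theory of `𝕄`. -/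
def AlterEgo.InModelClass (𝕄 : AlterEgo L M) (X : TopStruct 𝕄.sig) : Prop :=
  X.IsBoolean ∧
    ∀ σ : UHSentence 𝕄.sig, σ.Holds 𝕄.str.toPStruct → σ.Holds X.toPStruct

/-- `𝕄` is standard: the two classes coincide. -/
def AlterEgo.Standard (𝕄 : AlterEgo L M) : Prop :=
  ∀ X : TopStruct 𝕄.sig, 𝕄.InDualClass X ↔ 𝕄.InModelClass X

/-- The quasivariety generated by `M`: all non-empty algebras that embed into a power of `M`. -/
def InQuasivariety (L : FirstOrder.Language.{v, w}) (M : Type u) [L.Structure M]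
    (A : Type u) [L.Structure A] : Prop :=
  Nonempty A ∧ ∃ I : Type u, Nonempty (A ↪[L] (I → M))

/-- The underlying set of `D(A)` in `M ^ A`: all homomorphisms from `A` to `M`. -/
def homSet (L : FirstOrder.Language.{v, w}) (M : Type u) [L.Structure M]
    (A : Type u) [L.Structure A] : Set (A → M) :=
  {x | ∃ g : A →[L] M, ⇑g = x}

theorem CompatOp.mem_toPFun {n : ℕ} {h : CompatOp L M n} {a : Fin n → M} {b : M} :
    b ∈ h.toPFun a ↔ ∃ ha : a ∈ h.dom.alg, h.map ⟨a, ha⟩ = b := Iff.rfl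

/-- Compatible partial operations commute with the operations of `M`. -/
theorem CompatOp.funMap_mem {n k : ℕ} (h : CompatOp L M n) (f : L.Functions k)
    (x : Fin n → Fin k → M) (y : Fin k → M) (hxy : ∀ i, y i ∈ h.toPFun fun j => x j i) :
    FirstOrder.Language.Structure.funMap f y ∈ h.toPFun fun j => FirstOrder.Language.Structure.funMap f (x j) := by
  choose hd hy using hxy
  refine ⟨h.dom.alg.fun_mem f (fun i j => x j i) hd, ?_⟩
  have := h.map.map_fun f fun i => ⟨fun j => x j i, hd i⟩
  refine Eq.trans ?_ (this.trans ?_)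
  · rfl
  · congr 1
    funext i
    exact hy i

variable [L.IsAlgebraic]

theorem homSet_opClosed (𝕄 : AlterEgo L M) (A : Type u) [L.Structure A] :
    (𝕄.str.pow A).OpClosed (homSet L M A) := by
  intro h x hx y hy
  choose g hg using hx
  obtain ⟨hd, rfl⟩ := hy
  refine ⟨⟨_, ?_, ?_⟩, rfl⟩
  · intro k f a
    have key := h.1.2.funMap_mem f (fun j i => g j (a i))
      (fun i => (h.1.2.toPFun fun j => g j (a i)).get (by
        have := hd (a i)
        simp only [← hg] at this
        exact this)) (fun i => Part.get_mem _)
    obtain ⟨h1, h2⟩ := key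
    refine Eq.trans ?_ (h2.trans ?_)
    · change h.1.2.map _ = h.1.2.map _
      congr 1
      apply Subtype.ext
      funext j
      change x j (FirstOrder.Language.Structure.funMap f a) = FirstOrder.Language.Structure.funMap f fun i => g j (a i)
      rw [← hg j]
      exact (g j).map_fun f a
    · congr 1
      funext i
      change h.1.2.map _ = h.1.2.map _
      congr 1
      apply Subtype.ext
      funext j
      change g j (a i) = x j (a i)
      rw [hg j]
  · intro k r
    exact isEmptyElim r

/-- The dual `D(A)` of an algebra `A`: the substructure of the power `𝕄 ^ A` formed by the
homomorphisms from `A` to `M`. -/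
def AlterEgo.D (𝕄 : AlterEgo L M) (A : Type u) [L.Structure A] : TopStruct 𝕄.sig :=
  (𝕄.str.pow A).sub (homSet L M A) (homSet_opClosed 𝕄 A)

/-- The dual `E(X)` of a topological structure `X`: the subalgebra of the power `M ^ X` formed by
the morphisms from `X` to `𝕄`. -/
def AlterEgo.E (𝕄 : AlterEgo L M) (X : TopStruct 𝕄.sig) : L.Substructure (X → M) where
  carrier := {f | X.IsMorphism 𝕄.str f}
  fun_mem := by
    intro k F f hf
    refine ⟨?_, ?_, ?_⟩
    · let _ : TopologicalSpace M := ⊥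
      have : DiscreteTopology M := ⟨rfl⟩
      have h1 : Continuous fun x (i : Fin k) => f i x := continuous_pi fun i => (hf i).continuous
      have h2 : Continuous fun z : Fin k → M => FirstOrder.Language.Structure.funMap F z :=
        continuous_of_discreteTopology
      exact h2.comp h1
    · intro h x y hy
      exact h.1.2.funMap_mem F (fun j i => f i (x j)) (fun i => f i y)
        fun i => (hf i).map_op h x y hy
    · intro r x hx
      exact r.1.2.alg.fun_mem F (fun i j => f i (x j)) fun i => (hf i).map_rel r x hx

/-- The homomorphism `e_A : A → ED(A)`, `e_A(a)(x) = x(a)`. -/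
def AlterEgo.evalAlg (𝕄 : AlterEgo L M) (A : Type u) [L.Structure A] :
    A →[L] 𝕄.E (𝕄.D A) where
  toFun a := ⟨fun x => x.1 a, by
    refine ⟨?_, ?_, ?_⟩
    · exact (continuous_apply (A := fun _ : A => 𝕄.str.carrier) a).comp continuous_subtype_val
    · rintro h x y ⟨hd, rfl⟩
      exact Part.get_mem (hd a)
    · exact fun r x hx => hx a⟩
  map_fun' := by
    intro k f a
    apply Subtype.ext
    funext x
    obtain ⟨_, g, rfl⟩ := x
    exact g.map_fun f a
  map_rel' := by
    intro k r
    exact isEmptyElim r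

/-- The map `ε_X : X → DE(X)`, `ε_X(x)(u) = u(x)`. -/
def AlterEgo.evalStr (𝕄 : AlterEgo L M) (X : TopStruct 𝕄.sig) (x : X) :
    𝕄.D (𝕄.E X) :=
  ⟨fun u => u.1 x,
    ⟨fun u => u.1 x, fun _ _ => rfl, fun r => isEmptyElim r⟩, rfl⟩

/-- `𝕄` fully dualises `M`: all `e_A` with `A` in the quasivariety generated by `M`, and all
`ε_X` with `X` in the potential dual class of `𝕄`, are isomorphisms. -/
def AlterEgo.FullyDualises (𝕄 : AlterEgo L M) : Prop :=
  (∀ (A : Type u) [L.Structure A], InQuasivariety L M A →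
    Function.Bijective (𝕄.evalAlg A)) ∧
  (∀ X : TopStruct 𝕄.sig, 𝕄.InDualClass X →
    X.IsIsomorphism (𝕄.D (𝕄.E X)) (𝕄.evalStr X))

/-- `𝕄` fully dualises `M` at the finite level: the same for finite `A` and finite `X`. -/
def AlterEgo.FullyDualisesFinite (𝕄 : AlterEgo L M) : Prop :=
  (∀ (A : Type u) [L.Structure A], Finite A → InQuasivariety L M A →
    Function.Bijective (𝕄.evalAlg A)) ∧
  (∀ X : TopStruct 𝕄.sig, Finite X → 𝕄.InDualClass X →
    X.IsIsomorphism (𝕄.D (𝕄.E X)) (𝕄.evalStr X))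

end Algebra

end NatDual

/-!
Duality for `𝕄₁` is carried over to `𝕄₂` by turning each Boolean model `X` of the universal Horn
theory of `𝕄₂` into a structure `X₁` for `𝕄₁` on the same space (`HatChoice.translate`).

A compatible relation `r` is interpreted on `X` by the tuples `a` for which the formula defining `r̂`
has a solution `(a, w)` in `X` (`HatChoice.interp`). Implications that hold in `𝕄₂` between
conjunct-atomic formulas transfer to `X`, so implications between compatible relations with a
conclusion in the language of `𝕄₂` transfer to their interpretations (`HatChoice.transfer`). For a
conclusion outside this language the witnesses `w` have to be found in `X`; operational richness
gives them as values of terms (`HatChoice.exists_mem_interp`). With `CondOP` this shows that the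
interpretations of the relations and operations of `𝕄₂` are the given ones (`HatChoice.interp_rel`,
`HatChoice.interp_graph`), and with `CondAX` that `X₁` satisfies the basis of `𝕄₁`, hence the whole
theory of `𝕄₁` (`HatChoice.translate_models`). Compactness makes `X₁` Boolean
(`HatChoice.isBoolean_translate`).

Now `X` and `X₁` have the same morphisms to the alter egos (`HatChoice.E_translate`): if `(a, w)`
solves the formula for `r̂`, then `w` is a morphism from the finite dual `D₁(r)` to `X₁`, so by
duality a morphism `f : X₁ → 𝕄₁` composed with `w` is evaluation at a member of `r`, which is `f ∘ a`.

Since `X₁` belongs to the dual class of `𝕄₁`, by standardness or, if it is finite, by a diagram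
argument (`AlterEgo.InModelClass.inDualClass_of_finite`), it is isomorphic to its double dual. To
move this to `X`, the relations of `X` have to be reflected by the morphisms
(`HatChoice.mem_interp_of_forall`). If all morphisms map `a` into `r`, then composing them with the
homomorphisms `r → M` gives homomorphisms `E(X) → M`, which are evaluations at elements `w j`. This
`w` satisfies in `X₁` every formula that holds in `D₁(r)`; finitely many of these define `r̂` in
`𝕄₁`, by duality for `r`, and translating them back to `X` yields the formula for `r̂` in `X`.
-/

namespace NatDual

/-! ### Homomorphisms and joint embeddings of partial structures -/

section Structures

variable {S : Sig.{u}}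

theorem mem_piPart {ι X : Type*} {p : ι → Part X} {x : ι → X} :
    x ∈ piPart p ↔ ∀ i, x i ∈ p i :=
  ⟨by rintro ⟨h, rfl⟩ i; exact ⟨h i, rfl⟩, fun h => ⟨fun i => (h i).1, funext fun i => (h i).2⟩⟩

theorem Term.mem_eval_var {X : PStruct S} {n : ℕ} {a : Fin n → X} {i : Fin n} {b : X} :
    b ∈ (Term.var i : Term S n).eval X a ↔ b = a i := by
  simp [Term.eval]

theorem Term.mem_eval_app {X : PStruct S} {n : ℕ} {a : Fin n → X} {h : S.Op}
    {t : Fin (S.opArity h) → Term S n} {b : X} :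
    b ∈ (Term.app h t).eval X a ↔ ∃ c, (∀ j, c j ∈ (t j).eval X a) ∧ b ∈ X.op h c :=
  Part.mem_bind_iff.trans (exists_congr fun _ => and_congr_left fun _ => mem_piPart)

theorem Atom.holds_rel {X : PStruct S} {n : ℕ} {a : Fin n → X} {r : S.Rel}
    {t : Fin (S.relArity r) → Term S n} :
    (Atom.rel r t).Holds X a ↔ ∃ c, (∀ j, c j ∈ (t j).eval X a) ∧ c ∈ X.rel r := by
  simp [Atom.Holds, mem_piPart]

theorem Atom.holds_rel_var {X : PStruct S} {n : ℕ} {a : Fin n → X} {r : S.Rel}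
    {x : Fin (S.relArity r) → Fin n} :
    (Atom.rel r fun j => .var (x j)).Holds X a ↔ a ∘ x ∈ X.rel r := by
  simp only [Atom.holds_rel, Term.mem_eval_var]
  exact ⟨fun ⟨c, hc, h⟩ => (funext hc : c = a ∘ x) ▸ h, fun h => ⟨_, fun _ => rfl, h⟩⟩

theorem Term.mem_eval_app_var {X : PStruct S} {n : ℕ} {a : Fin n → X} {h : S.Op}
    {x : Fin (S.opArity h) → Fin n} {b : X} :
    b ∈ (Term.app h fun j => .var (x j)).eval X a ↔ b ∈ X.op h (a ∘ x) := by
  simp only [Term.mem_eval_app, Term.mem_eval_var]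
  exact ⟨fun ⟨c, hc, h⟩ => (funext hc : c = a ∘ x) ▸ h, fun h => ⟨_, fun _ => rfl, h⟩⟩

theorem Atom.holds_graph_var {X : PStruct S} {n : ℕ} {a : Fin n → X} {h : S.Op}
    {x : Fin (S.opArity h) → Fin n} {y : Fin n} :
    (Atom.eq (.app h fun j => .var (x j)) (.var y)).Holds X a ↔ a y ∈ X.op h (a ∘ x) := by
  simp only [Atom.Holds, Term.mem_eval_app_var, Term.mem_eval_var]
  simp

theorem Atom.holds_dom_var {X : PStruct S} {n : ℕ} {a : Fin n → X} {h : S.Op}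
    {x : Fin (S.opArity h) → Fin n} :
    (Atom.eq (.app h fun j => .var (x j)) (.app h fun j => .var (x j))).Holds X a ↔
      (X.op h (a ∘ x)).Dom := by
  simp only [Atom.Holds, Term.mem_eval_app_var, and_self]
  exact Part.dom_iff_mem.symm

theorem Atom.holds_eq_var {X : PStruct S} {n : ℕ} {a : Fin n → X} {i j : Fin n} :
    (Atom.eq (.var i) (.var j) : Atom S n).Holds X a ↔ a i = a j := by
  simp [Atom.Holds, Term.mem_eval_var]

theorem Term.eval_rename {X : PStruct S} {n k : ℕ} (ρ : Fin n → Fin k) (a : Fin k → X)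
    (t : Term S n) : (t.rename ρ).eval X a = t.eval X (a ∘ ρ) := by
  induction t with
  | var i => rfl
  | app h t ih => simp only [Term.rename, Term.eval, ih]

theorem Atom.holds_rename {X : PStruct S} {n k : ℕ} (ρ : Fin n → Fin k) (a : Fin k → X)
    (γ : Atom S n) : (γ.rename ρ).Holds X a ↔ γ.Holds X (a ∘ ρ) := by
  cases γ <;> simp only [Atom.rename, Atom.Holds, Term.eval_rename]

/-- Homomorphisms of partial structures: maps that preserve the relations and the partial
operations, wherever the latter are defined. -/
structure PStruct.IsHom (X Y : PStruct S) (f : X → Y) : Prop where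
  map_op : ∀ (h : S.Op) (x : Fin (S.opArity h) → X), ∀ y ∈ X.op h x, f y ∈ Y.op h (f ∘ x)
  map_rel : ∀ (r : S.Rel), ∀ x ∈ X.rel r, f ∘ x ∈ Y.rel r

namespace PStruct.IsHom

variable {X Y : PStruct S} {f : X → Y} (hf : X.IsHom Y f)
include hf

theorem mem_eval {n : ℕ} {a : Fin n → X} (t : Term S n) :
    ∀ {b : X}, b ∈ t.eval X a → f b ∈ t.eval Y (f ∘ a) := by
  induction t with
  | var i =>
    intro b hb
    rw [Term.mem_eval_var] at hb ⊢
    simp [hb]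
  | app h t ih =>
    intro b hb
    rw [Term.mem_eval_app] at hb ⊢
    obtain ⟨c, hc, hb⟩ := hb
    exact ⟨f ∘ c, fun j => ih j (hc j), hf.map_op h c b hb⟩

theorem holds {n : ℕ} {a : Fin n → X} {γ : Atom S n} (h : γ.Holds X a) : γ.Holds Y (f ∘ a) := by
  cases γ with
  | rel r t =>
    rw [Atom.holds_rel] at h ⊢
    obtain ⟨c, hc, h⟩ := h
    exact ⟨f ∘ c, fun j => hf.mem_eval (t j) (hc j), hf.map_rel r c h⟩
  | eq s t =>
    obtain ⟨b, hs, ht⟩ := h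
    exact ⟨f b, hf.mem_eval s hs, hf.mem_eval t ht⟩

theorem mem_solutions {n : ℕ} {a : Fin n → X} {Ψ : ConjAtomic S n} (h : a ∈ Ψ.solutions X) :
    f ∘ a ∈ Ψ.solutions Y :=
  fun ψ hψ => hf.holds (h ψ hψ)

end PStruct.IsHom

/-- A family of homomorphisms `f i : X → Y` that exhibits `X` as an isomorphic copy of a
substructure of the power `Y ^ I`: it separates points and jointly reflects the relations and the
domains of the partial operations. -/
structure PStruct.JointEmbedding (X Y : PStruct S) {I : Type*} (f : I → X → Y) : Prop where
  isHom : ∀ i, X.IsHom Y (f i)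
  injective : ∀ x y, (∀ i, f i x = f i y) → x = y
  dom : ∀ (h : S.Op) (x : Fin (S.opArity h) → X), (∀ i, (Y.op h (f i ∘ x)).Dom) → (X.op h x).Dom
  rel : ∀ (r : S.Rel) (x : Fin (S.relArity r) → X), (∀ i, f i ∘ x ∈ Y.rel r) → x ∈ X.rel r

namespace PStruct.JointEmbedding

variable {X Y : PStruct S} {I : Type*} {f : I → X → Y} (hf : X.JointEmbedding Y f)
include hf

theorem mem_op {h : S.Op} {x : Fin (S.opArity h) → X} {y : X}
    (hy : ∀ i, f i y ∈ Y.op h (f i ∘ x)) : y ∈ X.op h x := by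
  have hd := hf.dom h x fun i => (hy i).1
  refine ⟨hd, hf.injective _ _ fun i => ?_⟩
  exact Part.mem_unique ((hf.isHom i).map_op h x _ (Part.get_mem hd)) (hy i)

theorem eval_dom {n : ℕ} {a : Fin n → X} (t : Term S n) :
    (∀ i, (t.eval Y (f i ∘ a)).Dom) → (t.eval X a).Dom := by
  induction t with
  | var i => exact fun _ => trivial
  | app h t ih =>
    intro hd
    have hd' : ∀ i, ∃ c : Fin (S.opArity h) → Y, (∀ j, c j ∈ (t j).eval Y (f i ∘ a)) ∧
        (Y.op h c).Dom := fun i => by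
      obtain ⟨b, hb⟩ := Part.dom_iff_mem.1 (hd i)
      obtain ⟨c, hc, hb⟩ := Term.mem_eval_app.1 hb
      exact ⟨c, hc, hb.1⟩
    have hx : ∀ j, ∃ x, x ∈ (t j).eval X a := fun j =>
      Part.dom_iff_mem.1 (ih j fun i => by
        obtain ⟨c, hc, -⟩ := hd' i
        exact (hc j).1)
    choose x hx using hx
    have hdx := hf.dom h x fun i => by
      obtain ⟨c, hc, hd⟩ := hd' i
      have : f i ∘ x = c := funext fun j =>
        Part.mem_unique ((hf.isHom i).mem_eval (t j) (hx j)) (hc j)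
      rwa [this]
    exact Part.dom_iff_mem.2 ⟨_, Term.mem_eval_app.2 ⟨x, hx, Part.get_mem hdx⟩⟩

theorem holds {n : ℕ} {a : Fin n → X} {γ : Atom S n} (h : ∀ i, γ.Holds Y (f i ∘ a)) :
    γ.Holds X a := by
  cases γ with
  | rel r t =>
    simp only [Atom.holds_rel] at h ⊢
    choose c hc h using h
    have hx : ∀ j, ∃ x, x ∈ (t j).eval X a := fun j =>
      Part.dom_iff_mem.1 (hf.eval_dom (t j) fun i => (hc i j).1)
    choose x hx using hx
    refine ⟨x, hx, hf.rel r x fun i => ?_⟩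
    have : f i ∘ x = c i := funext fun j =>
      Part.mem_unique ((hf.isHom i).mem_eval (t j) (hx j)) (hc i j)
    rw [this]
    exact h i
  | eq s t =>
    choose b hs ht using h
    obtain ⟨x, hx⟩ := Part.dom_iff_mem.1 (hf.eval_dom s fun i => (hs i).1)
    obtain ⟨y, hy⟩ := Part.dom_iff_mem.1 (hf.eval_dom t fun i => (ht i).1)
    obtain rfl : x = y := hf.injective _ _ fun i =>
      (Part.mem_unique ((hf.isHom i).mem_eval s hx) (hs i)).trans
        (Part.mem_unique (ht i) ((hf.isHom i).mem_eval t hy))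
    exact ⟨x, hx, hy⟩

theorem mem_solutions {n : ℕ} {a : Fin n → X} {Ψ : ConjAtomic S n}
    (h : ∀ i, f i ∘ a ∈ Ψ.solutions Y) : a ∈ Ψ.solutions X :=
  fun ψ hψ => hf.holds fun i => h i ψ hψ

/-- Universal Horn sentences are preserved under substructures of non-zero powers. -/
theorem uhHolds [Nonempty I] {σ : UHSentence S} (h : σ.Holds Y) : σ.Holds X := by
  intro a ha
  have key : ∀ i, ∃ γ ∈ σ.conclusion, γ.Holds Y (f i ∘ a) := fun i =>
    h _ ((hf.isHom i).mem_solutions ha)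
  obtain ⟨γ, hγ, -⟩ := key (Classical.arbitrary I)
  refine ⟨γ, hγ, hf.holds fun i => ?_⟩
  obtain ⟨γ', hγ', h'⟩ := key i
  obtain rfl := Option.mem_unique hγ hγ'
  exact h'

end PStruct.JointEmbedding

/-- The coordinate projections are a joint embedding of a power. -/
theorem TopStruct.jointEmbedding_pow (Y : TopStruct S) (I : Type u) :
    (Y.pow I).toPStruct.JointEmbedding Y.toPStruct fun i x => x i where
  isHom i :=
    { map_op := by
        rintro h x _ ⟨hd, rfl⟩
        exact Part.get_mem (hd i)
      map_rel := fun r x hx => hx i }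
  injective _ _ h := funext h
  dom _ _ h := h
  rel _ _ h := h

/-- The coordinate projections are a joint embedding of a substructure of a power. -/
theorem TopStruct.jointEmbedding_sub_pow (Y : TopStruct S) (I : Type u) (U : Set (Y.pow I))
    (hU : (Y.pow I).OpClosed U) :
    ((Y.pow I).sub U hU).toPStruct.JointEmbedding Y.toPStruct fun i x => x.1 i where
  isHom i :=
    { map_op := by
        rintro h x _ ⟨hd, rfl⟩
        exact Part.get_mem (hd i)
      map_rel := fun r x hx => hx i }
  injective _ _ h := Subtype.ext (funext h)
  dom _ _ h := h
  rel _ _ h := h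

/-! ### Transfer of implications to models of a universal Horn theory -/

/-- `X` is a model of the universal Horn theory of `Y`. -/
def PStruct.Models (X Y : PStruct S) : Prop :=
  ∀ σ : UHSentence S, σ.Holds Y → σ.Holds X

namespace PStruct.Models

variable {X Y : PStruct S} (hX : X.Models Y)
include hX

/-- Implications from a finite family of conjunct-atomic formulas to an atomic formula or `⊥`
transfer from `Y` to models of its universal Horn theory. The variables are taken from an
arbitrary finite set `V`. -/
theorem transfer {V ι : Type*} [Finite V] [Finite ι] {n : ι → ℕ} (Φ : ∀ i, ConjAtomic S (n i))
    (ρ : ∀ i, Fin (n i) → V) {k : ℕ} (γ : Option (Atom S k)) (σ : Fin k → V)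
    (hY : ∀ a : V → Y, (∀ i, a ∘ ρ i ∈ (Φ i).solutions Y) → ∃ g ∈ γ, g.Holds Y (a ∘ σ))
    (a : V → X) (ha : ∀ i, a ∘ ρ i ∈ (Φ i).solutions X) : ∃ g ∈ γ, g.Holds X (a ∘ σ) := by
  obtain ⟨N, ⟨e⟩⟩ := Finite.exists_equiv_fin V
  obtain ⟨K, ⟨d⟩⟩ := Finite.exists_equiv_fin ι
  let P : ConjAtomic S N :=
    (List.finRange K).flatMap fun i => (Φ (d.symm i)).map (Atom.rename (e ∘ ρ (d.symm i)))
  have hP : ∀ (Z : PStruct S) (b : Fin N → Z),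
      b ∈ P.solutions Z ↔ ∀ i, (b ∘ e) ∘ ρ i ∈ (Φ i).solutions Z := by
    intro Z b
    constructor
    · intro h i ψ hψ
      have := h (ψ.rename (e ∘ ρ i)) (by
        refine List.mem_flatMap.2 ⟨d i, List.mem_finRange _, ?_⟩
        rw [d.symm_apply_apply]
        exact List.mem_map_of_mem hψ)
      rwa [Atom.holds_rename] at this
    · intro h ψ hψ
      obtain ⟨i, -, hi⟩ := List.mem_flatMap.1 hψ
      obtain ⟨ψ', hψ', rfl⟩ := List.mem_map.1 hi
      rw [Atom.holds_rename]
      exact h _ _ hψ'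
  have key := hX ⟨N, P, γ.map (Atom.rename (e ∘ σ))⟩ (by
    intro b hb
    obtain ⟨g, hg, h⟩ := hY (b ∘ e) ((hP Y b).1 hb)
    exact ⟨g.rename (e ∘ σ), Option.mem_map_of_mem _ hg, (Atom.holds_rename _ _ _).2 h⟩)
  obtain ⟨g', hg', h⟩ := key (a ∘ e.symm) ((hP X _).2 (by
    intro i
    have : (a ∘ e.symm) ∘ e = a := by funext; simp
    rw [this]
    exact ha i))
  obtain ⟨g, hg, rfl⟩ := Option.mem_map.1 hg'
  refine ⟨g, hg, ?_⟩
  rw [Atom.holds_rename] at h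
  have : (a ∘ e.symm) ∘ e ∘ σ = a ∘ σ := by funext; simp
  rwa [this] at h

theorem transfer_solutions {V ι : Type*} [Finite V] [Finite ι] {n : ι → ℕ}
    (Φ : ∀ i, ConjAtomic S (n i)) (ρ : ∀ i, Fin (n i) → V) {k : ℕ} (Ψ : ConjAtomic S k)
    (σ : Fin k → V)
    (hY : ∀ a : V → Y, (∀ i, a ∘ ρ i ∈ (Φ i).solutions Y) → a ∘ σ ∈ Ψ.solutions Y)
    (a : V → X) (ha : ∀ i, a ∘ ρ i ∈ (Φ i).solutions X) : a ∘ σ ∈ Ψ.solutions X := by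
  intro ψ hψ
  obtain ⟨g, hg, h⟩ := hX.transfer Φ ρ (some ψ) σ
    (fun a ha => ⟨ψ, rfl, hY a ha ψ hψ⟩) a ha
  obtain rfl := Option.mem_some_iff.1 hg
  exact h

theorem transfer_eq {V ι : Type*} [Finite V] [Finite ι] {n : ι → ℕ}
    (Φ : ∀ i, ConjAtomic S (n i)) (ρ : ∀ i, Fin (n i) → V) (x y : V)
    (hY : ∀ a : V → Y, (∀ i, a ∘ ρ i ∈ (Φ i).solutions Y) → a x = a y)
    (a : V → X) (ha : ∀ i, a ∘ ρ i ∈ (Φ i).solutions X) : a x = a y := by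
  obtain ⟨g, hg, h⟩ := hX.transfer Φ ρ (some (.eq (.var 0) (.var 1))) ![x, y]
    (fun a ha => ⟨_, rfl, Atom.holds_eq_var.2 (hY a ha)⟩) a ha
  obtain rfl := Option.mem_some_iff.1 hg
  exact Atom.holds_eq_var.1 h

theorem solutions_nonempty {n : ℕ} (Φ : ConjAtomic S n) (h : (Φ.solutions X).Nonempty) :
    (Φ.solutions Y).Nonempty := by
  by_contra hne
  obtain ⟨a, ha⟩ := h
  obtain ⟨_, hg, -⟩ := hX ⟨n, Φ, none⟩ (fun b hb => absurd ⟨b, hb⟩ hne) a ha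
  cases hg

/-- If `Ψ` can be satisfied in `Y` by the values of fixed terms `t` at each solution of `Φ`, then
the same holds in the models of the universal Horn theory of `Y`. -/
theorem transfer_terms {n k : ℕ} {W : Type*} [Finite W] (Φ : ConjAtomic S n) (t : W → Term S n)
    (Ψ : ConjAtomic S k) (ρ : Fin k → Fin n ⊕ W)
    (hY : ∀ a ∈ Φ.solutions Y, ∃ b : W → Y, (∀ j, b j ∈ (t j).eval Y a) ∧
      Sum.elim a b ∘ ρ ∈ Ψ.solutions Y)
    (a : Fin n → X) (ha : a ∈ Φ.solutions X) :
    ∃ b : W → X, Sum.elim a b ∘ ρ ∈ Ψ.solutions X := by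
  -- The terms are defined at `a`, because the implications `Φ → t j = t j` hold in `Y`.
  have hdef : ∀ j, ∃ b, b ∈ (t j).eval X a := by
    intro j
    obtain ⟨g, hg, h⟩ := hX ⟨n, Φ, some (.eq (t j) (t j))⟩ (by
      intro c hc
      obtain ⟨b, hb, -⟩ := hY c hc
      exact ⟨_, rfl, b j, hb j, hb j⟩) a ha
    obtain rfl := Option.mem_some_iff.1 hg
    obtain ⟨b, hb, -⟩ := h
    exact ⟨b, hb⟩
  choose b hb using hdef
  have hgraph : ∀ (Z : PStruct S) (c : Fin n ⊕ W → Z) (j : W),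
      (c ∘ Fin.snoc (α := fun _ => Fin n ⊕ W) Sum.inl (Sum.inr j)) ∈
        ConjAtomic.solutions [.eq ((t j).rename Fin.castSucc) (.var (Fin.last n))] Z ↔
      c (Sum.inr j) ∈ (t j).eval Z (c ∘ Sum.inl) := by
    intro Z c j
    simp only [ConjAtomic.solutions, Set.mem_ofPred_eq, List.mem_singleton, forall_eq, Atom.Holds,
      Term.mem_eval_var, Term.eval_rename, Function.comp_apply, Fin.snoc_last, exists_eq_right]
    have : (c ∘ Fin.snoc (α := fun _ => Fin n ⊕ W) Sum.inl (Sum.inr j)) ∘ Fin.castSucc =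
        c ∘ Sum.inl := by
      funext i
      simp
    rw [this]
  refine ⟨b, hX.transfer_solutions (V := Fin n ⊕ W) (ι := Option W)
    (n := fun o => o.elim n fun _ => n + 1)
    (Φ := fun o => match o with
      | none => Φ
      | some j => [.eq ((t j).rename Fin.castSucc) (.var (Fin.last n))])
    (ρ := fun o => match o with
      | none => Sum.inl
      | some j => Fin.snoc (α := fun _ => Fin n ⊕ W) Sum.inl (Sum.inr j))
    Ψ ρ ?_ (Sum.elim a b) ?_⟩
  · intro c hc
    obtain ⟨b', hb', h⟩ := hY (c ∘ Sum.inl) (hc none)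
    have hcb : Sum.elim (c ∘ Sum.inl) b' = c := by
      funext z
      rcases z with i | j
      · rfl
      · exact Part.mem_unique (hb' j) ((hgraph Y c j).1 (hc (some j)))
    rwa [hcb] at h
  · rintro (_ | j)
    · exact ha
    · exact (hgraph X _ j).2 (hb j)

end PStruct.Models

end Structures

/-! ### Compatible relations and terms of an alter ego -/

section Compat

variable {L : FirstOrder.Language.{v, w}} {M : Type u} [L.Structure M]

open FirstOrder.Language.Structure (funMap)

theorem comp_append {A B : Type*} {m n : ℕ} (f : A → B) (x : Fin m → A) (y : Fin n → A) :
    f ∘ Fin.append x y = Fin.append (f ∘ x) (f ∘ y) := by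
  funext i
  refine Fin.addCases (fun i => ?_) (fun i => ?_) i <;> simp

theorem comp_snoc {A B : Type*} {n : ℕ} (f : A → B) (x : Fin n → A) (y : A) :
    f ∘ (Fin.snoc x y : Fin (n + 1) → A) = (Fin.snoc (f ∘ x) (f y) : Fin (n + 1) → B) := by
  funext i
  refine Fin.lastCases ?_ (fun i => ?_) i <;> simp

theorem CompatOp.snoc_mem_graph {n : ℕ} (h : CompatOp L M n) (a : Fin n → M) (b : M) :
    (Fin.snoc a b : Fin (n + 1) → M) ∈ h.graph.alg ↔ b ∈ h.toPFun a := by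
  constructor
  · rintro ⟨⟨a', ha'⟩, e⟩
    obtain ⟨rfl, rfl⟩ := Fin.snoc_inj.1 e
    exact ⟨ha', rfl⟩
  · rintro ⟨ha, rfl⟩
    exact ⟨⟨a, ha⟩, rfl⟩

theorem HypPure.holds_str {𝕄 : AlterEgo L M} {n : ℕ} (α : HypPure 𝕄.sig n)
    (a : Fin n → 𝕄.str) :
    α.toAtom.Holds 𝕄.str.toPStruct a ↔ a ∘ α.vars ∈ α.compatRel.alg := by
  cases α with
  | rel r x => exact Atom.holds_rel_var
  | graph h x y =>
    refine Atom.holds_graph_var.trans (((h.1.2.snoc_mem_graph (a ∘ x) (a y))).symm.trans ?_)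
    exact iff_of_eq (congrArg (· ∈ h.1.2.graph.alg) (comp_snoc a x y).symm)

namespace AlterEgo

variable (𝕄 : AlterEgo L M)

/-- The operations of the algebra are homomorphisms from finite powers of the alter ego. -/
theorem isHom_funMap {k : ℕ} (F : L.Functions k) :
    (𝕄.str.pow (ULift (Fin k))).toPStruct.IsHom 𝕄.str.toPStruct
      fun x => (funMap F fun i => x ⟨i⟩ : M) where
  map_op := by
    rintro h x _ ⟨hd, rfl⟩
    exact h.1.2.funMap_mem F (fun j i => x j ⟨i⟩) _ fun i => ⟨hd ⟨i⟩, rfl⟩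
  map_rel r x hx := r.1.2.alg.fun_mem F (fun i j => x j ⟨i⟩) fun i => hx ⟨i⟩

variable {𝕄}

theorem funMap_mem_solutions {n : ℕ} (Ψ : ConjAtomic 𝕄.sig n) {k : ℕ} (F : L.Functions k)
    (x : Fin k → Fin n → M) (hx : ∀ i, x i ∈ Ψ.solutions 𝕄.str.toPStruct) :
    funMap F x ∈ Ψ.solutions 𝕄.str.toPStruct :=
  (𝕄.isHom_funMap F).mem_solutions
    (a := fun j (i : ULift (Fin k)) => x i.down j)
    ((𝕄.str.jointEmbedding_pow _).mem_solutions fun i => hx i.down)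

/-- The non-empty relation defined by a conjunct-atomic formula, as a compatible relation. -/
def solRel {n : ℕ} (Ψ : ConjAtomic 𝕄.sig n)
    (hne : (Ψ.solutions 𝕄.str.toPStruct).Nonempty) : CompatRel L M n where
  alg := { carrier := Ψ.solutions 𝕄.str.toPStruct
           fun_mem := fun F x hx => funMap_mem_solutions Ψ F x hx }
  nonempty := hne

end AlterEgo

/-- Substitution of terms for the variables of a term. -/
def Term.subst {S : Sig.{u}} {n k : ℕ} (s : Fin k → Term S n) : Term S k → Term S n
  | .var i => s i
  | .app h t => .app h fun j => (t j).subst s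

theorem Term.mem_eval_subst {S : Sig.{u}} {X : PStruct S} {n k : ℕ} {s : Fin k → Term S n}
    {a : Fin n → X} {b : Fin k → X} (hs : ∀ i, b i ∈ (s i).eval X a) (t : Term S k) :
    ∀ {c : X}, c ∈ t.eval X b → c ∈ (t.subst s).eval X a := by
  induction t with
  | var i =>
    intro c hc
    rw [Term.mem_eval_var] at hc
    exact hc ▸ hs i
  | app h t ih =>
    intro c hc
    obtain ⟨d, hd, hc⟩ := Term.mem_eval_app.1 hc
    exact Term.mem_eval_app.2 ⟨d, fun j => ih j (hd j), hc⟩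

/-- Every member of the enriched partial clone extends to a term function. The two need not be
equal: a composite with a projection can lose part of its domain. -/
theorem AlterEgo.Clo.exists_term {𝕄 : AlterEgo L M} {n : ℕ} {g : (Fin n → M) →. M}
    (hg : 𝕄.Clo n g) :
    ∃ t : Term 𝕄.sig n, ∀ a, ∀ b ∈ g a, b ∈ t.eval 𝕄.str.toPStruct a := by
  induction hg with
  | @basic n h hh =>
    refine ⟨.app ⟨⟨n, h⟩, hh⟩ fun j => .var j, fun a b hb => ?_⟩
    exact Term.mem_eval_app.2 ⟨a, fun j => Term.mem_eval_var.2 rfl, hb⟩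
  | proj i =>
    refine ⟨.var i, fun a b hb => ?_⟩
    exact Term.mem_eval_var.2 (Part.mem_some_iff.1 hb)
  | comp f g hf hg hne ihf ihg =>
    obtain ⟨t, ht⟩ := ihf
    choose s hs using ihg
    refine ⟨t.subst s, fun a b hb => ?_⟩
    obtain ⟨c, hc, hb⟩ := Part.mem_bind_iff.1 hb
    exact Term.mem_eval_subst (fun j => hs j a _ (mem_piPart.1 hc j)) t (ht c b hb)

theorem AlterEgo.OpRich.exists_term {𝕄 : AlterEgo L M} {n : ℕ} {r : CompatRel L M n}
    (hr : 𝕄.OpRich (r.alg : Set (Fin n → M))) (f : r.alg →[L] M) :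
    ∃ t : Term 𝕄.sig n, ∀ a : r.alg, f a ∈ t.eval 𝕄.str.toPStruct a.1 := by
  obtain ⟨g, hg, hfg⟩ := hr ⟨r, f⟩ rfl
  obtain ⟨t, ht⟩ := hg.exists_term
  exact ⟨t, fun a => ht _ _ (hfg a)⟩

/-! ### Compatible relations on a structure -/

variable {𝕄 : AlterEgo L M} (τ : HatChoice 𝕄)

/-- The interpretation on a structure `X` of an arbitrary compatible relation `r`: the tuples
that extend to a solution in `X` of the chosen formula defining `r̂`. -/
def HatChoice.interp (X : PStruct 𝕄.sig) {n : ℕ} (r : CompatRel L M n) : Set (Fin n → X) :=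
  {a | ∃ w : Fin (τ.m r) → X, Fin.append a w ∈ (τ.formula r).solutions X}

theorem HatChoice.append_mem_str {n : ℕ} (r : CompatRel L M n) (a : Fin n → M)
    (w : Fin (τ.m r) → M) :
    Fin.append a w ∈ (τ.formula r).solutions 𝕄.str.toPStruct ↔
      ∃ ha : a ∈ r.alg, ∀ j, w j = τ.enum r j ⟨a, ha⟩ := by
  rw [τ.defines r]
  constructor
  · rintro ⟨⟨a', ha'⟩, e⟩
    have e1 : a = a' := funext fun i => by
      have := congrFun e (Fin.castAdd _ i)
      simpa using this
    subst e1
    refine ⟨ha', fun j => ?_⟩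
    have := congrFun e (Fin.natAdd _ j)
    simpa using this
  · rintro ⟨ha, hw⟩
    obtain rfl : w = fun j => τ.enum r j ⟨a, ha⟩ := funext hw
    exact ⟨⟨a, ha⟩, rfl⟩

theorem HatChoice.mem_interp_str {n : ℕ} (r : CompatRel L M n) (a : Fin n → M) :
    a ∈ τ.interp 𝕄.str.toPStruct r ↔ a ∈ r.alg :=
  ⟨fun ⟨w, hw⟩ => ((τ.append_mem_str r a w).1 hw).1,
    fun ha => ⟨fun j => τ.enum r j ⟨a, ha⟩, (τ.append_mem_str r a _).2 ⟨ha, fun _ => rfl⟩⟩⟩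

theorem HatChoice.interp_map {X : PStruct 𝕄.sig} {f : X → M}
    (hf : X.IsHom 𝕄.str.toPStruct f) {n : ℕ} (r : CompatRel L M n) {a : Fin n → X}
    (ha : a ∈ τ.interp X r) : f ∘ a ∈ r.alg := by
  obtain ⟨w, hw⟩ := ha
  have : Fin.append (f ∘ a) (f ∘ w) ∈ (τ.formula r).solutions 𝕄.str.toPStruct :=
    comp_append f a w ▸ hf.mem_solutions hw
  exact (τ.mem_interp_str r _).1 ⟨_, this⟩

variable {X : PStruct 𝕄.sig} (hX : X.Models 𝕄.str.toPStruct)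
include hX

/-- Implications between compatible relations, with an atomic conclusion, transfer from `M` to
the interpretations of these relations on a model. -/
theorem HatChoice.transfer {V ι : Type*} [Finite V] [Finite ι] {n : ι → ℕ}
    (r : ∀ i, CompatRel L M (n i)) (ρ : ∀ i, Fin (n i) → V) {k : ℕ} (γ : Option (Atom 𝕄.sig k))
    (σ : Fin k → V)
    (hM : ∀ a : V → M, (∀ i, a ∘ ρ i ∈ (r i).alg) →
      ∃ g ∈ γ, g.Holds 𝕄.str.toPStruct (a ∘ σ))
    (a : V → X) (ha : ∀ i, a ∘ ρ i ∈ τ.interp X (r i)) : ∃ g ∈ γ, g.Holds X (a ∘ σ) := by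
  choose w hw using ha
  refine hX.transfer (V := V ⊕ Σ i, Fin (τ.m (r i))) (fun i => τ.formula (r i))
    (fun i => Fin.append (Sum.inl ∘ ρ i) fun j => Sum.inr ⟨i, j⟩) γ (Sum.inl ∘ σ)
    (fun c hc => hM (c ∘ Sum.inl) fun i => ?_) (Sum.elim a fun z => w z.1 z.2) fun i => ?_
  · have := hc i
    rw [comp_append] at this
    exact (τ.mem_interp_str (r i) _).1 ⟨_, this⟩
  · rw [comp_append]
    exact hw i

theorem HatChoice.transfer_solutions {V ι : Type*} [Finite V] [Finite ι] {n : ι → ℕ}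
    (r : ∀ i, CompatRel L M (n i)) (ρ : ∀ i, Fin (n i) → V) {k : ℕ} (Ψ : ConjAtomic 𝕄.sig k)
    (σ : Fin k → V)
    (hM : ∀ a : V → M, (∀ i, a ∘ ρ i ∈ (r i).alg) → a ∘ σ ∈ Ψ.solutions 𝕄.str.toPStruct)
    (a : V → X) (ha : ∀ i, a ∘ ρ i ∈ τ.interp X (r i)) : a ∘ σ ∈ Ψ.solutions X := by
  intro ψ hψ
  obtain ⟨g, hg, h⟩ := τ.transfer hX r ρ (some ψ) σ (fun a ha => ⟨ψ, rfl, hM a ha ψ hψ⟩) a ha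
  obtain rfl := Option.mem_some_iff.1 hg
  exact h

theorem HatChoice.transfer_eq {V ι : Type*} [Finite V] [Finite ι] {n : ι → ℕ}
    (r : ∀ i, CompatRel L M (n i)) (ρ : ∀ i, Fin (n i) → V) (x y : V)
    (hM : ∀ a : V → M, (∀ i, a ∘ ρ i ∈ (r i).alg) → a x = a y)
    (a : V → X) (ha : ∀ i, a ∘ ρ i ∈ τ.interp X (r i)) : a x = a y := by
  obtain ⟨g, hg, h⟩ := τ.transfer hX r ρ (some (.eq (.var 0) (.var 1))) ![x, y]
    (fun a ha => ⟨_, rfl, Atom.holds_eq_var.2 (hM a ha)⟩) a ha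
  obtain rfl := Option.mem_some_iff.1 hg
  exact Atom.holds_eq_var.1 h

/-- If `𝕄` is operationally rich at the relation defined by `Φ`, then implications from `Φ` to a
compatible relation `s` transfer to models. The coordinates of `s` are variables of `Φ` or values of
homomorphisms `q` on the relation defined by `Φ`; by richness, both the latter and the coordinates
of `ŝ` beyond those of `s` are values of terms. -/
theorem HatChoice.exists_mem_interp [L.IsAlgebraic] {N k : ℕ} (Φ : ConjAtomic 𝕄.sig N)
    (hne : (Φ.solutions 𝕄.str.toPStruct).Nonempty)
    (hΦ : 𝕄.OpRich (Φ.solutions 𝕄.str.toPStruct)) (s : CompatRel L M k) {W : Type*} [Finite W]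
    (ρ : Fin k → Fin N ⊕ W) (q : W → ((AlterEgo.solRel Φ hne).alg →[L] M))
    (hq : ∀ a : (AlterEgo.solRel Φ hne).alg, Sum.elim a.1 (fun j => q j a) ∘ ρ ∈ s.alg)
    (c : Fin N → X) (hc : c ∈ Φ.solutions X) :
    ∃ b : W → X, Sum.elim c b ∘ ρ ∈ τ.interp X s := by
  -- The homomorphism from the relation defined by `Φ` to `s` that is described by `ρ` and `q`.
  let p : (AlterEgo.solRel Φ hne).alg →[L] s.alg :=
    { toFun := fun a => ⟨Sum.elim a.1 (fun j => q j a) ∘ ρ, hq a⟩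
      map_fun' := by
        intro l F a
        apply Subtype.ext
        funext i
        change Sum.elim _ _ (ρ i) = funMap F fun z => Sum.elim _ _ (ρ i)
        rcases ρ i with i | j
        · rfl
        · exact (q j).map_fun F a
      map_rel' := fun r => isEmptyElim r }
  have ht : ∀ z : W ⊕ Fin (τ.m s), ∃ t : Term 𝕄.sig N, ∀ a : (AlterEgo.solRel Φ hne).alg,
      Sum.elim (fun j => q j a) (fun j => τ.enum s j (p a)) z ∈ t.eval 𝕄.str.toPStruct a.1 := by
    rintro (j | j)
    · exact AlterEgo.OpRich.exists_term (r := AlterEgo.solRel Φ hne) hΦ (q j)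
    · exact AlterEgo.OpRich.exists_term (r := AlterEgo.solRel Φ hne) hΦ ((τ.enum s j).comp p)
  choose t ht using ht
  obtain ⟨b, hb⟩ := hX.transfer_terms Φ t (τ.formula s)
    (Fin.append (Sum.map id Sum.inl ∘ ρ) fun j => Sum.inr (Sum.inr j)) (by
      intro a ha
      refine ⟨_, fun z => ht z ⟨a, ha⟩, ?_⟩
      rw [comp_append]
      refine (τ.append_mem_str s _ _).2 ?_
      have e : (Sum.elim a (Sum.elim (fun j => q j ⟨a, ha⟩) fun j => τ.enum s j (p ⟨a, ha⟩)) ∘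
          Sum.map id Sum.inl ∘ ρ : Fin k → M) = (p ⟨a, ha⟩).1 := by
        funext i
        change _ = Sum.elim a (fun j => q j ⟨a, ha⟩) (ρ i)
        simp only [Function.comp_apply]
        rcases ρ i with i | j <;> rfl
      have hmem : ∀ {z : Fin k → M} {w : Fin (τ.m s) → M} (y : s.alg), z = y.1 →
          (∀ j, w j = τ.enum s j y) → ∃ hz : z ∈ s.alg, ∀ j, w j = τ.enum s j ⟨z, hz⟩ := by
        rintro _ w y rfl hw
        exact ⟨y.2, hw⟩
      exact hmem _ e fun j => rfl) c hc
  refine ⟨b ∘ Sum.inl, b ∘ Sum.inr, ?_⟩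
  rw [comp_append] at hb
  have e : Sum.elim c b ∘ Sum.map id Sum.inl ∘ ρ = Sum.elim c (b ∘ Sum.inl) ∘ ρ := by
    funext i
    simp only [Function.comp_apply]
    rcases ρ i with i | j <;> rfl
  rw [e] at hb
  exact hb

theorem HatChoice.mem_interp_of_opRich [L.IsAlgebraic] {N k : ℕ} (Φ : ConjAtomic 𝕄.sig N)
    (hΦ : 𝕄.OpRich (Φ.solutions 𝕄.str.toPStruct)) (s : CompatRel L M k) (x : Fin k → Fin N)
    (hs : ∀ a ∈ Φ.solutions 𝕄.str.toPStruct, a ∘ x ∈ s.alg)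
    (c : Fin N → X) (hc : c ∈ Φ.solutions X) : c ∘ x ∈ τ.interp X s := by
  obtain ⟨b, hb⟩ := τ.exists_mem_interp hX Φ (hX.solutions_nonempty Φ ⟨c, hc⟩) hΦ s
    (Sum.inl ∘ x) (fun j : Empty => j.elim) (fun a => hs a.1 a.2) c hc
  exact hb

theorem HatChoice.exists_mem_interp_graph [L.IsAlgebraic] {N k : ℕ} (Φ : ConjAtomic 𝕄.sig N)
    (hΦ : 𝕄.OpRich (Φ.solutions 𝕄.str.toPStruct)) (h : CompatOp L M k) (x : Fin k → Fin N)
    (hh : ∀ a ∈ Φ.solutions 𝕄.str.toPStruct, a ∘ x ∈ h.dom.alg)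
    (c : Fin N → X) (hc : c ∈ Φ.solutions X) :
    ∃ b : X, (Fin.snoc (c ∘ x) b : Fin (k + 1) → X) ∈ τ.interp X h.graph := by
  have hne := hX.solutions_nonempty Φ ⟨c, hc⟩
  let p : (AlterEgo.solRel Φ hne).alg →[L] h.dom.alg :=
    { toFun := fun a => ⟨a.1 ∘ x, hh a.1 a.2⟩
      map_fun' := fun _ _ => rfl
      map_rel' := fun r => isEmptyElim r }
  obtain ⟨b, hb⟩ := τ.exists_mem_interp hX Φ hne hΦ h.graph
    (Fin.snoc (α := fun _ => Fin N ⊕ Unit) (Sum.inl ∘ x) (Sum.inr ()))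
    (fun _ : Unit => h.map.comp p) (fun a => by
      rw [comp_snoc]
      exact (h.snoc_mem_graph _ _).2 ⟨(p a).2, rfl⟩) c hc
  rw [comp_snoc] at hb
  exact ⟨b (), hb⟩

theorem HatChoice.interp_rel [L.IsAlgebraic] (op : 𝕄.CondOP) (r : 𝕄.sig.Rel) :
    τ.interp X r.1.2 = X.rel r := by
  ext a
  constructor
  · intro ha
    have := τ.transfer_solutions hX (V := Fin r.1.1) (fun _ : Unit => r.1.2) (fun _ => id)
      [.rel r fun j => .var j] id (fun b hb ψ hψ => by
        obtain rfl := List.mem_singleton.1 hψ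
        exact Atom.holds_rel_var.2 (hb ())) a (fun _ => ha)
    exact Atom.holds_rel_var.1 (this _ (List.mem_singleton.2 rfl))
  · intro ha
    have e : ConjAtomic.solutions [.rel r fun j => .var j] 𝕄.str.toPStruct =
        (r.1.2.alg : Set (Fin r.1.1 → M)) := by
      ext b
      simp only [ConjAtomic.solutions, List.mem_singleton, forall_eq]
      exact Atom.holds_rel_var
    refine τ.mem_interp_of_opRich hX (N := r.1.1) [.rel r fun j => .var j] ?_ r.1.2 id ?_ a ?_
    · rw [e]
      exact op.1 _ _ r.2
    · intro b hb
      rw [e] at hb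
      exact hb
    · intro ψ hψ
      obtain rfl := List.mem_singleton.1 hψ
      exact Atom.holds_rel_var.2 ha

omit hX in
theorem solutions_dom (Z : PStruct 𝕄.sig) (h : 𝕄.sig.Op) :
    ConjAtomic.solutions [.eq (.app h fun j => .var j) (.app h fun j => .var j)] Z =
      (Z.op h).Dom := by
  ext b
  simp only [ConjAtomic.solutions, List.mem_singleton, forall_eq]
  exact Atom.holds_dom_var

theorem HatChoice.interp_graph [L.IsAlgebraic] (op : 𝕄.CondOP) (h : 𝕄.sig.Op)
    (a : Fin h.1.1 → X) (b : X) :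
    (Fin.snoc a b : Fin (h.1.1 + 1) → X) ∈ τ.interp X h.1.2.graph ↔ b ∈ X.op h a := by
  have to_op : ∀ b, (Fin.snoc a b : Fin (h.1.1 + 1) → X) ∈ τ.interp X h.1.2.graph →
      b ∈ X.op h a := by
    intro b hb
    have := τ.transfer_solutions hX (V := Fin (h.1.1 + 1)) (fun _ : Unit => h.1.2.graph)
      (fun _ => id) [.eq (.app h fun j => .var j.castSucc) (.var (Fin.last _))] id
      (fun c hc ψ hψ => by
        obtain rfl := List.mem_singleton.1 hψ
        refine Atom.holds_graph_var.2 ((h.1.2.snoc_mem_graph _ _).1 ?_)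
        have : (Fin.snoc (c ∘ Fin.castSucc) (c (Fin.last _)) : Fin (h.1.1 + 1) → M) = c :=
          Fin.snoc_init_self c
        exact (congrArg (· ∈ h.1.2.graph.alg) this).mpr (hc ()))
      (Fin.snoc a b : Fin (h.1.1 + 1) → X) (fun _ => hb)
    have := Atom.holds_graph_var.1 (this _ (List.mem_singleton.2 rfl))
    have e : ((Fin.snoc a b : Fin (h.1.1 + 1) → X) ∘ id) ∘ Fin.castSucc = a := by
      funext i
      simp
    rw [e] at this
    simpa using this
  refine ⟨to_op b, fun hb => ?_⟩
  obtain ⟨b', hb'⟩ := τ.exists_mem_interp_graph hX (N := h.1.1)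
    [.eq (.app h fun j => .var j) (.app h fun j => .var j)] (by
      rw [solutions_dom]
      exact op.2 _ _ h.2) h.1.2 id (by
      intro c hc
      rw [solutions_dom] at hc
      exact hc) a (by
      rw [solutions_dom]
      exact hb.1)
  exact Part.mem_unique hb (to_op b' hb') ▸ hb'

end Compat

/-! ### The translated structure -/

section Translate

variable {L : FirstOrder.Language.{v, w}} {M : Type u} [L.Structure M]
variable {𝕄₁ 𝕄₂ : AlterEgo L M} (τ : HatChoice 𝕄₂)

/-- The structure in the signature of `𝕄₁` that a structure `X` in the signature of `𝕄₂` carries,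
on the same topological space: the compatible relations and the graphs of the compatible partial
operations of `𝕄₁` are interpreted by `HatChoice.interp`. The choice of a value of an operation is
immaterial on models of the theory of `𝕄₂`, where the value is unique. -/
noncomputable def HatChoice.translate (𝕄₁ : AlterEgo L M) (X : TopStruct 𝕄₂.sig) :
    TopStruct 𝕄₁.sig where
  carrier := X
  op h a := ⟨∃ b, (Fin.snoc a b : Fin (h.1.1 + 1) → X) ∈ τ.interp X.toPStruct h.1.2.graph,
    fun hd => hd.choose⟩
  rel r := τ.interp X.toPStruct r.1.2
  top := X.top

theorem HatChoice.mem_translate_op {X : TopStruct 𝕄₂.sig}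
    (hX : X.toPStruct.Models 𝕄₂.str.toPStruct) (h : 𝕄₁.sig.Op) (a : Fin h.1.1 → X) (b : X) :
    b ∈ (τ.translate 𝕄₁ X).op h a ↔
      (Fin.snoc a b : Fin (h.1.1 + 1) → X) ∈ τ.interp X.toPStruct h.1.2.graph := by
  constructor
  · rintro ⟨hd, rfl⟩
    exact hd.choose_spec
  · intro hb
    have hd : ∃ b, (Fin.snoc a b : Fin (h.1.1 + 1) → X) ∈ τ.interp X.toPStruct h.1.2.graph :=
      ⟨b, hb⟩
    refine ⟨hd, ?_⟩
    refine τ.transfer_eq hX (V := Fin h.1.1 ⊕ Bool) (fun _ : Bool => h.1.2.graph)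
      (fun i => Fin.snoc (α := fun _ => Fin h.1.1 ⊕ Bool) Sum.inl (Sum.inr i))
      (Sum.inr true) (Sum.inr false) (fun c hc => ?_)
      (Sum.elim a fun i => cond i hd.choose b) ?_
    · have hc' := fun i => (h.1.2.snoc_mem_graph (c ∘ Sum.inl) (c (Sum.inr i))).1
        ((congrArg (· ∈ h.1.2.graph.alg) (comp_snoc c Sum.inl (Sum.inr i))).mp (hc i))
      exact Part.mem_unique (hc' true) (hc' false)
    · rintro (_ | _)
      · rw [comp_snoc]
        exact hb
      · rw [comp_snoc]
        exact hd.choose_spec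

theorem HatChoice.holds_translate {X : TopStruct 𝕄₂.sig}
    (hX : X.toPStruct.Models 𝕄₂.str.toPStruct) {n : ℕ} (α : HypPure 𝕄₁.sig n) (a : Fin n → X) :
    α.toAtom.Holds (τ.translate 𝕄₁ X).toPStruct a ↔
      a ∘ α.vars ∈ τ.interp X.toPStruct α.compatRel := by
  cases α with
  | rel r x => exact Atom.holds_rel_var
  | graph h x y =>
    refine Atom.holds_graph_var.trans ((τ.mem_translate_op hX h (a ∘ x) (a y)).trans ?_)
    exact iff_of_eq (congrArg (· ∈ τ.interp X.toPStruct h.1.2.graph) (comp_snoc a x y).symm)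

theorem PureUH.mem_solutions_natPremise (φ : PureUH 𝕄₁.sig) (X : PStruct 𝕄₂.sig)
    (c : Fin (φ.natArity τ) → X) :
    c ∈ (φ.natPremise τ).solutions X ↔
      ∀ i, Fin.append (c ∘ Fin.castAdd _ ∘ (φ.premise i).vars)
        (fun j => c (Fin.natAdd φ.n (finSigmaFinEquiv ⟨i, j⟩))) ∈
          (τ.formula (φ.premise i).compatRel).solutions X := by
  have e : ∀ i, c ∘ Fin.addCases
        (fun j => Fin.castAdd _ ((φ.premise i).vars j))
        (fun j => Fin.natAdd φ.n (finSigmaFinEquiv ⟨i, j⟩)) =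
      Fin.append (c ∘ Fin.castAdd _ ∘ (φ.premise i).vars)
        (fun j => c (Fin.natAdd φ.n (finSigmaFinEquiv ⟨i, j⟩))) :=
    fun i => comp_append c _ _
  constructor
  · intro h i ψ hψ
    rw [← e i, ← Atom.holds_rename]
    exact h _ (List.mem_flatMap.2 ⟨i, List.mem_finRange _, List.mem_map_of_mem hψ⟩)
  · intro h ψ hψ
    obtain ⟨i, -, hi⟩ := List.mem_flatMap.1 hψ
    obtain ⟨ψ', hψ', rfl⟩ := List.mem_map.1 hi
    rw [Atom.holds_rename, e i]
    exact h i ψ' hψ'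

theorem PureUH.mem_solutions_premise (φ : PureUH 𝕄₁.sig) (X : PStruct 𝕄₁.sig)
    (a : Fin φ.n → X) :
    a ∈ φ.toUH.premise.solutions X ↔ ∀ i, (φ.premise i).toAtom.Holds X a := by
  constructor
  · exact fun h i => h _ (List.mem_ofFn.2 ⟨i, rfl⟩)
  · intro h ψ hψ
    obtain ⟨i, rfl⟩ := List.mem_ofFn.1 hψ
    exact h i

/-- The translated structure satisfies each pure sentence `φ` that holds in `𝕄₁`, if its
conclusion is in the language of `𝕄₂` or `𝕄₂` is operationally rich at the relation defined by
the translated premise. -/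
theorem HatChoice.translate_holds [L.IsAlgebraic] (op : 𝕄₂.CondOP) {X : TopStruct 𝕄₂.sig}
    (hX : X.toPStruct.Models 𝕄₂.str.toPStruct) (φ : PureUH 𝕄₁.sig)
    (hφ : φ.toUH.Holds 𝕄₁.str.toPStruct)
    (ax : ¬ φ.conclusion.InLanguageOf 𝕄₂ →
      𝕄₂.OpRich ((φ.natPremise τ).solutions 𝕄₂.str.toPStruct)) :
    φ.toUH.Holds (τ.translate 𝕄₁ X).toPStruct := by
  intro (a : Fin φ.n → X) ha
  have ha' : ∀ i, a ∘ (φ.premise i).vars ∈ τ.interp X.toPStruct (φ.premise i).compatRel :=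
    fun i => (τ.holds_translate hX _ _).1 ((φ.mem_solutions_premise _ _).1 ha i)
  have hM : ∀ b : Fin φ.n → M, (∀ i, b ∘ (φ.premise i).vars ∈ (φ.premise i).compatRel.alg) →
      ∃ γ ∈ φ.conclusion.toConclusion, γ.Holds 𝕄₁.str.toPStruct b := fun b hb =>
    hφ b ((φ.mem_solutions_premise _ _).2 fun i => ((φ.premise i).holds_str b).2 (hb i))
  change ∃ γ ∈ φ.conclusion.toConclusion, γ.Holds (τ.translate 𝕄₁ X).toPStruct a
  -- Conclusions in the language of `𝕄₂` transfer directly. For the others, a solution of the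
  -- translated premise is assembled from `a` and the tuples that witness the interpretations.
  have hrich : ¬ φ.conclusion.InLanguageOf 𝕄₂ → ∃ c ∈ (φ.natPremise τ).solutions X.toPStruct,
      c ∘ Fin.castAdd _ = a := fun _ => by
    choose w hw using ha'
    let w' : Fin (∑ i, τ.m (φ.premise i).compatRel) → X := fun z =>
      (fun z : Σ i, Fin (τ.m (φ.premise i).compatRel) => w z.1 z.2) (finSigmaFinEquiv.symm z)
    have hw' : ∀ i j, w' (finSigmaFinEquiv ⟨i, j⟩) = w i j := fun i j =>
      congrArg (fun z : Σ i, Fin (τ.m (φ.premise i).compatRel) => w z.1 z.2)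
        (finSigmaFinEquiv.symm_apply_apply _)
    refine ⟨Fin.append (α := X) a w', (φ.mem_solutions_natPremise τ _ _).2 fun i => ?_,
      funext fun j => Fin.append_left _ _ j⟩
    have e : Fin.append (α := X) a w' ∘ Fin.castAdd _ ∘ (φ.premise i).vars =
        a ∘ (φ.premise i).vars := funext fun j => Fin.append_left _ _ _
    simp only [e, Fin.append_right, hw']
    exact hw i
  have hnat : ∀ b ∈ (φ.natPremise τ).solutions 𝕄₂.str.toPStruct,
      ∃ γ ∈ φ.conclusion.toConclusion, γ.Holds 𝕄₁.str.toPStruct (b ∘ Fin.castAdd _) :=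
    fun b hb => hM _ fun i =>
      (τ.mem_interp_str _ _).1 ⟨_, (φ.mem_solutions_natPremise τ _ b).1 hb i⟩
  clear ha hφ
  generalize φ.conclusion = γ at *
  by_cases hγ : γ.InLanguageOf 𝕄₂
  · cases γ with
    | rel r x =>
      obtain ⟨g, hg, h⟩ := τ.transfer hX (fun i => (φ.premise i).compatRel)
        (fun i => (φ.premise i).vars)
        (some (.rel (⟨r.1, hγ⟩ : 𝕄₂.sig.Rel) fun j => .var (x j))) id (fun b hb => by
          obtain ⟨g, hg, h⟩ := hM b hb
          obtain rfl := Option.mem_some_iff.1 hg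
          exact ⟨_, rfl, Atom.holds_rel_var.2 (Atom.holds_rel_var.1 h :)⟩) a ha'
      obtain rfl := Option.mem_some_iff.1 hg
      refine ⟨_, rfl, Atom.holds_rel_var.2 ?_⟩
      have := Atom.holds_rel_var.1 h
      rw [← τ.interp_rel hX op] at this
      exact this
    | dom f x =>
      obtain ⟨g, hg, h⟩ := τ.transfer hX (fun i => (φ.premise i).compatRel)
        (fun i => (φ.premise i).vars)
        (some (.eq (.app (⟨f.1, hγ⟩ : 𝕄₂.sig.Op) fun j => .var (x j))
          (.app (⟨f.1, hγ⟩ : 𝕄₂.sig.Op) fun j => .var (x j)))) id (fun b hb => by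
          obtain ⟨g, hg, h⟩ := hM b hb
          obtain rfl := Option.mem_some_iff.1 hg
          exact ⟨_, rfl, Atom.holds_dom_var.2 (Atom.holds_dom_var.1 h :)⟩) a ha'
      obtain rfl := Option.mem_some_iff.1 hg
      refine ⟨_, rfl, Atom.holds_dom_var.2 ?_⟩
      have := Atom.holds_dom_var.1 h
      exact ⟨_, (τ.interp_graph hX op ⟨f.1, hγ⟩ (a ∘ x) _).2 (Part.get_mem this)⟩
    | eq i j =>
      refine ⟨_, rfl, Atom.holds_eq_var.2 ?_⟩
      refine τ.transfer_eq hX (fun i => (φ.premise i).compatRel)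
        (fun i => (φ.premise i).vars) i j (fun b hb => ?_) a ha'
      obtain ⟨g, hg, h⟩ := hM b hb
      obtain rfl := Option.mem_some_iff.1 hg
      exact Atom.holds_eq_var.1 h
    | bot =>
      obtain ⟨g, hg, -⟩ := τ.transfer hX (fun i => (φ.premise i).compatRel)
        (fun i => (φ.premise i).vars) (none : Option (Atom 𝕄₂.sig φ.n)) id (fun b hb => by
          obtain ⟨g, hg, -⟩ := hM b hb
          cases hg) a ha'
      cases hg
  · obtain ⟨c, hc, rfl⟩ := hrich hγ
    cases γ with
    | rel r x =>
      refine ⟨_, rfl, Atom.holds_rel_var.2 ?_⟩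
      refine τ.mem_interp_of_opRich hX _ (ax hγ) r.1.2 (Fin.castAdd _ ∘ x) (fun b hb => ?_) c hc
      obtain ⟨g, hg, h⟩ := hnat b hb
      obtain rfl := Option.mem_some_iff.1 hg
      exact Atom.holds_rel_var.1 h
    | dom f x =>
      refine ⟨_, rfl, Atom.holds_dom_var.2 ?_⟩
      refine τ.exists_mem_interp_graph hX _ (ax hγ) f.1.2 (Fin.castAdd _ ∘ x) (fun b hb => ?_) c hc
      obtain ⟨g, hg, h⟩ := hnat b hb
      obtain rfl := Option.mem_some_iff.1 hg
      exact Atom.holds_dom_var.1 h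
    | eq i j => exact absurd trivial hγ
    | bot => exact absurd trivial hγ

theorem HatChoice.translate_models [L.IsAlgebraic] (op : 𝕄₂.CondOP) {Γ : Set (PureUH 𝕄₁.sig)}
    (hΓ : IsPureBasis Γ 𝕄₁.str.toPStruct) (ax : CondAX Γ τ) {X : TopStruct 𝕄₂.sig}
    (hX : X.toPStruct.Models 𝕄₂.str.toPStruct) :
    (τ.translate 𝕄₁ X).toPStruct.Models 𝕄₁.str.toPStruct :=
  fun σ hσ => hΓ.2 σ hσ _ fun φ hφ => τ.translate_holds op hX φ (hΓ.1 φ hφ) (ax φ hφ)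

/-! ### Duals of compatible relations -/

/-- The index, in the enumeration of the homomorphisms from `r`, of a coordinate projection. -/
def HatChoice.projIdx [L.IsAlgebraic] {n : ℕ} (r : CompatRel L M n) (i : Fin n) : Fin (τ.m r) :=
  (τ.enum r).symm
    { toFun := fun a => a.1 i
      map_fun' := fun _ _ => rfl
      map_rel' := fun s => isEmptyElim s }

theorem HatChoice.enum_projIdx [L.IsAlgebraic] {n : ℕ} (r : CompatRel L M n) (i : Fin n)
    (a : r.alg) : τ.enum r (τ.projIdx r i) a = a.1 i := by
  rw [HatChoice.projIdx, Equiv.apply_symm_apply]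
  rfl

theorem HatChoice.witness_projIdx [L.IsAlgebraic] {X : PStruct 𝕄₂.sig}
    (hX : X.Models 𝕄₂.str.toPStruct) {n : ℕ} (r : CompatRel L M n) {a : Fin n → X}
    {w : Fin (τ.m r) → X} (hw : Fin.append a w ∈ (τ.formula r).solutions X) (i : Fin n) :
    w (τ.projIdx r i) = a i := by
  have := hX.transfer_eq (fun _ : Unit => τ.formula r)
    (fun _ => Fin.append (m := n) (n := τ.m r) Sum.inl Sum.inr)
    (Sum.inr (τ.projIdx r i)) (Sum.inl i) (fun c hc => by
      have h := hc ()
      rw [comp_append] at h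
      obtain ⟨ha, h⟩ := (τ.append_mem_str r _ _).1 h
      exact (h _).trans (τ.enum_projIdx r i _)) (Sum.elim a w) (fun _ => by
      rw [comp_append]
      exact hw)
  exact this

/-- If `w` witnesses that a tuple belongs to the interpretation of `r`, then the map that sends the
`j`-th homomorphism `r → M` to `w j` preserves all compatible relations `s` from the dual of `r`,
where they hold pointwise, to `X`. -/
theorem HatChoice.witness_mem_interp [L.IsAlgebraic] {X : PStruct 𝕄₂.sig}
    (hX : X.Models 𝕄₂.str.toPStruct) {n : ℕ} (r : CompatRel L M n) {a : Fin n → X}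
    {w : Fin (τ.m r) → X} (hw : Fin.append a w ∈ (τ.formula r).solutions X) {k : ℕ}
    (s : CompatRel L M k) (y : Fin k → Fin (τ.m r))
    (hs : ∀ b : r.alg, (fun j => τ.enum r (y j) b) ∈ s.alg) : w ∘ y ∈ τ.interp X s := by
  let p : r.alg →[L] s.alg :=
    { toFun := fun b => ⟨fun j => τ.enum r (y j) b, hs b⟩
      map_fun' := by
        intro l F b
        apply Subtype.ext
        funext i
        exact (τ.enum r (y i)).map_fun F b
      map_rel' := fun s => isEmptyElim s }
  refine ⟨fun l => w ((τ.enum r).symm ((τ.enum s l).comp p)), ?_⟩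
  have := hX.transfer_solutions (fun _ : Unit => τ.formula r)
    (fun _ => Fin.append (m := n) (n := τ.m r) Sum.inl Sum.inr) (τ.formula s)
    (Fin.append (Sum.inr ∘ y) fun l => Sum.inr ((τ.enum r).symm ((τ.enum s l).comp p)))
    (fun c hc => by
      have h := hc ()
      rw [comp_append] at h ⊢
      obtain ⟨ha, h⟩ := (τ.append_mem_str r _ _).1 h
      obtain ⟨b, hb⟩ : ∃ b : r.alg, ∀ j, c (Sum.inr j) = τ.enum r j b := ⟨_, h⟩
      have e : (c ∘ Sum.inr ∘ y : Fin k → M) = (p b).1 := funext fun j => hb (y j)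
      refine (τ.append_mem_str s _ _).2 ⟨(congrArg (· ∈ s.alg) e).mpr (p b).2, fun l => ?_⟩
      refine (hb _).trans ?_
      rw [Equiv.apply_symm_apply]
      change τ.enum s l (p b) = _
      congr 1
      exact Subtype.ext e.symm) (Sum.elim a w) (fun _ => by
      rw [comp_append]
      exact hw)
  rw [comp_append] at this
  exact this

/-- A map is a homomorphism if it preserves the pure atomic formulas true of an enumeration of its
domain. -/
theorem isHom_of_holds {S : Sig.{u}} {X Y : PStruct S} {N : ℕ} {e : Fin N → X}
    (he : Function.Surjective e) {f : X → Y}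
    (h : ∀ α : HypPure S N, α.toAtom.Holds X e → α.toAtom.Holds Y (f ∘ e)) : X.IsHom Y f where
  map_op := by
    intro g x y hy
    obtain ⟨x, rfl⟩ : ∃ x', x = e ∘ x' := ⟨_, funext fun j => (Function.surjInv_eq he (x j)).symm⟩
    obtain ⟨y, rfl⟩ := he y
    exact Atom.holds_graph_var.1 (h (.graph g x y) (Atom.holds_graph_var.2 hy))
  map_rel := by
    intro r x hx
    obtain ⟨x, rfl⟩ : ∃ x', x = e ∘ x' := ⟨_, funext fun j => (Function.surjInv_eq he (x j)).symm⟩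
    exact Atom.holds_rel_var.1 (h (.rel r x) (Atom.holds_rel_var.2 hx))

/-- Over a finite structure, a set of pure atomic formulas in finitely many variables is equivalent
to a finite subset of it. -/
theorem exists_list_holds_iff {S : Sig.{u}} (Y : PStruct S) [Finite Y] {N : ℕ}
    (D : Set (HypPure S N)) :
    ∃ Δ : List (HypPure S N), (∀ α ∈ Δ, α ∈ D) ∧
      ∀ g : Fin N → Y, (∀ α ∈ Δ, α.toAtom.Holds Y g) → ∀ α ∈ D, α.toAtom.Holds Y g := by
  classical
  have := Fintype.ofFinite {g : Fin N → Y // ∃ α ∈ D, ¬ α.toAtom.Holds Y g}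
  let c : {g : Fin N → Y // ∃ α ∈ D, ¬ α.toAtom.Holds Y g} → HypPure S N :=
    fun g => g.2.choose
  refine ⟨Finset.univ.toList.map c, ?_, ?_⟩
  · intro α hα
    obtain ⟨g, -, rfl⟩ := List.mem_map.1 hα
    exact g.2.choose_spec.1
  · intro g hg α hα
    by_contra hn
    have hex : ∃ α ∈ D, ¬ α.toAtom.Holds Y g := ⟨α, hα, hn⟩
    exact hex.choose_spec.2
      (hg _ (List.mem_map.2 ⟨⟨g, hex⟩, by simp, rfl⟩))

/-- `𝕄` dualises `M` at the finite level: the evaluation maps of the finite algebras in the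
quasivariety are isomorphisms. -/
def AlterEgo.DualisesFinite [L.IsAlgebraic] (𝕄 : AlterEgo L M) : Prop :=
  ∀ (A : Type u) [L.Structure A], Finite A → InQuasivariety L M A →
    Function.Bijective (𝕄.evalAlg A)

theorem CompatRel.inQuasivariety {n : ℕ} (r : CompatRel L M n) :
    InQuasivariety L M r.alg := by
  obtain ⟨a, ha⟩ := r.nonempty
  refine ⟨⟨a, ha⟩, ULift (Fin n), ⟨⟨⟨fun b i => b.1 i.down, ?_⟩, ?_, ?_⟩⟩⟩
  · intro b c h
    apply Subtype.ext
    funext i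
    exact congrFun h ⟨i⟩
  · intro l F x
    rfl
  · intro l R x
    change (∀ i : ULift (Fin n), _) ↔ ∀ i : Fin n, _
    exact ⟨fun h i => h ⟨i⟩, fun h i => h i.down⟩

theorem AlterEgo.t2Space_D [L.IsAlgebraic] (𝕄 : AlterEgo L M) (A : Type u) [L.Structure A] :
    T2Space (𝕄.D A) := by
  let _ : TopologicalSpace M := ⊥
  have : DiscreteTopology M := ⟨rfl⟩
  exact inferInstanceAs (T2Space (homSet L M A))

/-- Over an alter ego that dualises at the finite level, the pure atomic formulas that hold of the
homomorphisms `r → M` in the dual of `r` are only satisfied in `M` by the values of these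
homomorphisms at the members of `r`. -/
theorem AlterEgo.DualisesFinite.exists_enum_eq [L.IsAlgebraic] [Finite M] {𝕄 : AlterEgo L M}
    (hd : 𝕄.DualisesFinite) {n m : ℕ} (r : CompatRel L M n) (e : Fin m ≃ (r.alg →[L] M))
    (g : Fin m → M)
    (hg : ∀ α : HypPure 𝕄.sig m, (∀ b : r.alg, (fun j => e (α.vars j) b) ∈ α.compatRel.alg) →
      g ∘ α.vars ∈ α.compatRel.alg) :
    ∃ b : r.alg, ∀ j, g j = e j b := by
  let d : Fin m → 𝕄.D r.alg := fun j => ⟨⇑(e j), e j, rfl⟩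
  have hd_surj : Function.Surjective d := by
    rintro ⟨_, f, rfl⟩
    refine ⟨e.symm f, Subtype.ext ?_⟩
    change ⇑(e (e.symm f)) = _
    rw [Equiv.apply_symm_apply]
  have hd_inj : Function.Injective d := fun i j h =>
    e.injective (DFunLike.coe_injective (congrArg Subtype.val h))
  let d' : Fin m ≃ 𝕄.D r.alg := Equiv.ofBijective d ⟨hd_inj, hd_surj⟩
  let f : 𝕄.D r.alg → 𝕄.str := g ∘ d'.symm
  have hfd : f ∘ d = g := by
    funext j
    exact congrArg g (d'.symm_apply_apply j)
  have hf : (𝕄.D r.alg).toPStruct.IsHom 𝕄.str.toPStruct f := by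
    refine isHom_of_holds hd_surj fun α hα => ?_
    refine (α.holds_str _).2 ?_
    rw [hfd]
    refine hg α fun b => ?_
    exact (α.holds_str _).1 (((𝕄.str.jointEmbedding_sub_pow _ _ _).isHom b).holds hα)
  have hcont : Continuous f := by
    have : T2Space (𝕄.D r.alg) := 𝕄.t2Space_D _
    have : Finite (𝕄.D r.alg) := Finite.of_equiv _ d'
    exact continuous_of_discreteTopology
  obtain ⟨b, hb⟩ := (hd r.alg inferInstance r.inQuasivariety).2 ⟨f, hcont, hf.map_op, hf.map_rel⟩
  refine ⟨b, fun j => ?_⟩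
  have := congrFun (congrArg Subtype.val hb) (d j)
  rw [← hfd]
  exact this.symm

/-! ### Morphisms from the translated structure -/

theorem AlterEgo.isHom_of_mem_E [L.IsAlgebraic] {𝕄 : AlterEgo L M} {X : TopStruct 𝕄.sig}
    {f : X → M} (hf : f ∈ 𝕄.E X) : X.toPStruct.IsHom 𝕄.str.toPStruct f :=
  ⟨TopStruct.IsMorphism.map_op hf, TopStruct.IsMorphism.map_rel hf⟩

/-- A structure and its translation have the same morphisms to the respective alter egos. That a
morphism `f` from the translation preserves each compatible relation `r` follows from duality for
`r`: a witness `w` for membership in the interpretation of `r` is a morphism from the dual of `r`,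
so `f ∘ w` is an evaluation. -/
theorem HatChoice.E_translate [L.IsAlgebraic] [Finite M] (op : 𝕄₂.CondOP)
    (hd : 𝕄₁.DualisesFinite) {X : TopStruct 𝕄₂.sig}
    (hX : X.toPStruct.Models 𝕄₂.str.toPStruct) :
    (𝕄₁.E (τ.translate 𝕄₁ X) : L.Substructure (X → M)) = 𝕄₂.E X := by
  apply SetLike.ext
  intro f
  constructor
  · intro hf
    have hpres : ∀ {n} (r : CompatRel L M n) (a : Fin n → X),
        a ∈ τ.interp X.toPStruct r → f ∘ a ∈ r.alg := by
      rintro n r a ⟨w, hw⟩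
      obtain ⟨b, hb⟩ := hd.exists_enum_eq r (τ.enum r) (f ∘ w) fun α hα =>
        (α.holds_str _).1 ((AlterEgo.isHom_of_mem_E hf).holds
          ((τ.holds_translate hX α w).2 (τ.witness_mem_interp hX r hw _ _ hα)))
      have e : f ∘ a = b.1 := by
        funext i
        rw [← τ.enum_projIdx r i b, ← hb]
        exact congrArg f (τ.witness_projIdx hX r hw i).symm
      rw [e]
      exact b.2
    refine ⟨TopStruct.IsMorphism.continuous hf, fun h x y hy => ?_, fun r x hx => ?_⟩
    · refine (h.1.2.snoc_mem_graph _ _).1 ?_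
      exact (congrArg (· ∈ h.1.2.graph.alg) (comp_snoc f x y)).mp
        (hpres h.1.2.graph _ ((τ.interp_graph hX op h x y).2 hy))
    · refine hpres r.1.2 x ?_
      rw [τ.interp_rel hX op r]
      exact hx
  · intro hf
    have hpres : ∀ {n} (r : CompatRel L M n) (a : Fin n → X),
        a ∈ τ.interp X.toPStruct r → f ∘ a ∈ r.alg :=
      fun r a ha => τ.interp_map (AlterEgo.isHom_of_mem_E hf) r ha
    refine ⟨TopStruct.IsMorphism.continuous hf, fun h x y hy => ?_, fun r x hx => hpres _ _ hx⟩
    refine (h.1.2.snoc_mem_graph _ _).1 ?_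
    exact (congrArg (· ∈ h.1.2.graph.alg) (comp_snoc f x y)).mp
      (hpres h.1.2.graph _ ((τ.mem_translate_op hX h x y).1 hy))

/-- If the translated structure embeds into a power of `𝕄₁` by its morphisms to `𝕄₁`, and every
homomorphism from the algebra of these morphisms is an evaluation, then the interpretations of
compatible relations are jointly reflected by the morphisms. Indeed the images under the
homomorphisms `r → M` of a tuple `a` that is mapped into `r` by all morphisms are again given by
elements `w j` of `X`, and `w` satisfies a finite conjunction of pure formulas that defines `r̂`
in `𝕄₁`. -/
theorem HatChoice.mem_interp_of_forall [L.IsAlgebraic] [Finite M]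
    (hd : 𝕄₁.DualisesFinite) {X : TopStruct 𝕄₂.sig}
    (hX : X.toPStruct.Models 𝕄₂.str.toPStruct) (E : L.Substructure (X → M))
    (hE : (τ.translate 𝕄₁ X).toPStruct.JointEmbedding 𝕄₁.str.toPStruct fun u : E => u.1)
    (hsurj : ∀ g : E →[L] M, ∃ x : X, ∀ u : E, g u = u.1 x)
    {n : ℕ} (r : CompatRel L M n) (a : Fin n → X) (ha : ∀ u : E, u.1 ∘ a ∈ r.alg) :
    a ∈ τ.interp X.toPStruct r := by
  let p : E →[L] r.alg :=
    { toFun := fun u => ⟨u.1 ∘ a, ha u⟩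
      map_fun' := fun _ _ => rfl
      map_rel' := fun s => isEmptyElim s }
  have hw : ∀ j, ∃ x : X, ∀ u : E, τ.enum r j (p u) = u.1 x :=
    fun j => hsurj ((τ.enum r j).comp p)
  choose w hw using hw
  have : Finite 𝕄₁.str := ‹Finite M›
  obtain ⟨Δ, hΔ, hΔ'⟩ := exists_list_holds_iff (N := τ.m r) 𝕄₁.str.toPStruct
    {α | ∀ b : r.alg, (fun j => τ.enum r (α.vars j) b) ∈ α.compatRel.alg}
  have hwΔ : ∀ α ∈ Δ, w ∘ α.vars ∈ τ.interp X.toPStruct α.compatRel := by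
    intro α hα
    refine (τ.holds_translate hX α w).1 (hE.holds fun u => (α.holds_str _).2 ?_)
    have e : (u.1 ∘ w) ∘ α.vars = fun j => τ.enum r (α.vars j) (p u) :=
      funext fun j => (hw _ u).symm
    exact (congrArg (· ∈ α.compatRel.alg) e).mpr (hΔ α hα (p u))
  have ha' : w ∘ τ.projIdx r = a := by
    funext i
    refine hE.injective _ _ fun u => ?_
    exact (hw _ u).symm.trans (τ.enum_projIdx r i (p u))
  have : Finite {α // α ∈ Δ} := (List.finite_toSet Δ).to_subtype
  refine ⟨w, ?_⟩
  have := τ.transfer_solutions hX (fun α : {α // α ∈ Δ} => α.1.compatRel) (fun α => α.1.vars)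
    (τ.formula r) (Fin.append (τ.projIdx r) id) (fun c hc => by
      obtain ⟨b, hb⟩ := hd.exists_enum_eq r (τ.enum r) c fun α hα =>
        (α.holds_str _).1 (hΔ' c (fun β hβ => (β.holds_str _).2 (hc ⟨β, hβ⟩)) α hα)
      rw [comp_append]
      have e : (c ∘ τ.projIdx r : Fin n → M) = b.1 := by
        funext i
        exact (hb _).trans (τ.enum_projIdx r i b)
      refine (τ.append_mem_str r _ _).2 ⟨(congrArg (· ∈ r.alg) e).mpr b.2, fun j => (hb j).trans ?_⟩
      congr 1
      exact Subtype.ext e.symm) w fun α => hwΔ α.1 α.2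
  rw [comp_append, ha'] at this
  exact this

/-- Under the assumptions of `HatChoice.mem_interp_of_forall`, the structure itself embeds into a
power of `𝕄₂`. -/
theorem HatChoice.jointEmbedding_of_translate [L.IsAlgebraic] [Finite M] (op : 𝕄₂.CondOP)
    (hd : 𝕄₁.DualisesFinite) {X : TopStruct 𝕄₂.sig}
    (hX : X.toPStruct.Models 𝕄₂.str.toPStruct)
    (hE : (τ.translate 𝕄₁ X).toPStruct.JointEmbedding 𝕄₁.str.toPStruct fun u : 𝕄₂.E X => u.1)
    (hsurj : ∀ g : 𝕄₂.E X →[L] M, ∃ x : X, ∀ u : 𝕄₂.E X, g u = u.1 x) :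
    X.toPStruct.JointEmbedding 𝕄₂.str.toPStruct fun u : 𝕄₂.E X => u.1 where
  isHom u := AlterEgo.isHom_of_mem_E u.2
  injective := hE.injective
  dom := by
    intro h x hx
    let p : 𝕄₂.E X →[L] h.1.2.dom.alg :=
      { toFun := fun u => ⟨u.1 ∘ x, hx u⟩
        map_fun' := fun _ _ => rfl
        map_rel' := fun s => isEmptyElim s }
    obtain ⟨y, hy⟩ := hsurj (h.1.2.map.comp p)
    refine ((τ.interp_graph hX op h x y).1 ?_).1
    refine τ.mem_interp_of_forall hd hX _ hE hsurj _ _ fun u => ?_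
    rw [comp_snoc]
    exact (h.1.2.snoc_mem_graph _ _).2 ⟨hx u, hy u⟩
  rel := by
    intro r x hx
    rw [← τ.interp_rel hX op r]
    exact τ.mem_interp_of_forall hd hX _ hE hsurj _ _ hx

end Translate

/-! ### Boolean structures and the dual class -/

section Topology

theorem isClosed_exists {A B : Type*} [TopologicalSpace A] [TopologicalSpace B] [CompactSpace B]
    {P : A → B → Prop} (h : IsClosed {p : A × B | P p.1 p.2}) : IsClosed {a | ∃ b, P a b} := by
  have e : {a | ∃ b, P a b} = Prod.fst '' {p : A × B | P p.1 p.2} := by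
    ext a
    exact ⟨fun ⟨b, hb⟩ => ⟨(a, b), hb, rfl⟩, fun ⟨p, hp, hpa⟩ => ⟨p.2, hpa ▸ hp⟩⟩
  rw [e]
  exact isClosedMap_fst_of_compactSpace _ h

theorem isClosed_forall {A ι : Type*} [TopologicalSpace A] {P : ι → A → Prop}
    (h : ∀ j, IsClosed {a | P j a}) : IsClosed {a | ∀ j, P j a} := by
  rw [Set.ofPred_forall]
  exact isClosed_iInter h

variable {S : Sig.{u}}

/-- On a Boolean space, closed relations and partial operations with closed graphs form a Boolean
structure. -/
theorem TopStruct.isBoolean_of_isClosed_graph {X : TopStruct S} (hc : CompactSpace X)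
    (h2 : T2Space X) (ht : TotallyDisconnectedSpace X) (hr : ∀ r : S.Rel, IsClosed (X.rel r))
    (hg : ∀ h : S.Op, IsClosed {p : (Fin (S.opArity h) → X) × X | p.2 ∈ X.op h p.1}) :
    X.IsBoolean where
  compact := hc
  hausdorff := h2
  totallyDisconnected := ht
  isClosed_rel := hr
  isClosed_dom h := by
    have e : (X.op h).Dom = {a | ∃ b, b ∈ X.op h a} := by
      ext a
      exact Part.dom_iff_mem
    rw [e]
    exact isClosed_exists (P := fun a b => b ∈ X.op h a) (hg h)
  continuous_op h := by
    rw [continuous_iff_isClosed]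
    intro C hC
    have e : (fun x : (X.op h).Dom => (X.op h).fn x.1 x.2) ⁻¹' C =
        {x | ∃ b, b ∈ X.op h x.1 ∧ b ∈ C} := by
      ext x
      exact ⟨fun hx => ⟨_, ⟨x.2, rfl⟩, hx⟩, fun ⟨b, ⟨hd, hb⟩, hbC⟩ => (congrArg (· ∈ C) hb).mpr hbC⟩
    rw [e]
    refine isClosed_exists (P := fun (x : (X.op h).Dom) b => b ∈ X.op h x.1 ∧ b ∈ C) ?_
    refine IsClosed.inter ?_ (hC.preimage continuous_snd)
    exact (hg h).preimage ((continuous_subtype_val.comp continuous_fst).prodMk continuous_snd)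

namespace TopStruct.IsBoolean

variable {X : TopStruct S} (hX : X.IsBoolean)
include hX

theorem isClosed_graph (h : S.Op) :
    IsClosed {p : (Fin (S.opArity h) → X) × X | p.2 ∈ X.op h p.1} := by
  have := hX.hausdorff
  let ι : (X.op h).Dom × X → (Fin (S.opArity h) → X) × X := Prod.map Subtype.val id
  have hι : Topology.IsClosedEmbedding ι :=
    (hX.isClosed_dom h).isClosedEmbedding_subtypeVal.prodMap Topology.IsClosedEmbedding.id
  have e : {p : (Fin (S.opArity h) → X) × X | p.2 ∈ X.op h p.1} =
      ι '' {q | (X.op h).fn q.1.1 q.1.2 = q.2} := by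
    ext p
    constructor
    · rintro ⟨hd, hp⟩
      exact ⟨(⟨p.1, hd⟩, p.2), hp, rfl⟩
    · rintro ⟨q, hq, rfl⟩
      exact ⟨q.1.2, hq⟩
  rw [e]
  exact hι.isClosedMap _
    (isClosed_eq ((hX.continuous_op h).comp continuous_fst) continuous_snd)

theorem isClosed_eval {n : ℕ} (t : Term S n) :
    IsClosed {p : (Fin n → X) × X | p.2 ∈ t.eval X.toPStruct p.1} := by
  have := hX.hausdorff
  have := hX.compact
  induction t with
  | var i =>
    simp only [Term.mem_eval_var]
    exact isClosed_eq continuous_snd ((continuous_apply i).comp continuous_fst)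
  | app h t ih =>
    simp only [Term.mem_eval_app]
    refine isClosed_exists (P := fun (p : (Fin n → X) × X) c =>
      (∀ j, c j ∈ (t j).eval X.toPStruct p.1) ∧ p.2 ∈ X.op h c) ?_
    refine IsClosed.inter (isClosed_forall fun j => ?_) ((hX.isClosed_graph h).preimage
      (continuous_snd.prodMk (continuous_snd.comp continuous_fst)))
    exact (ih j).preimage (f := fun q : ((Fin n → X) × X) × (Fin (S.opArity h) → X) =>
      (q.1.1, q.2 j)) ((continuous_fst.comp continuous_fst).prodMk ((continuous_apply j).comp continuous_snd))

theorem isClosed_solutions {n : ℕ} (Ψ : ConjAtomic S n) : IsClosed (Ψ.solutions X.toPStruct) := by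
  have := hX.hausdorff
  have := hX.compact
  have e : Ψ.solutions X.toPStruct = ⋂ ψ ∈ Ψ, {a | ψ.Holds X.toPStruct a} := by
    ext a
    simp [ConjAtomic.solutions]
  rw [e]
  refine isClosed_biInter fun ψ _ => ?_
  cases ψ with
  | rel r t =>
    simp only [Atom.holds_rel]
    refine isClosed_exists (P := fun (a : Fin n → X) c =>
      (∀ j, c j ∈ (t j).eval X.toPStruct a) ∧ c ∈ X.rel r) ?_
    refine IsClosed.inter (isClosed_forall fun j => ?_)
      ((hX.isClosed_rel r).preimage continuous_snd)
    exact (hX.isClosed_eval (t j)).preimage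
      (f := fun q : (Fin n → X) × (Fin (S.relArity r) → X) => (q.1, q.2 j)) (continuous_fst.prodMk ((continuous_apply j).comp continuous_snd))
  | eq s t =>
    exact isClosed_exists (P := fun (a : Fin n → X) b =>
      b ∈ s.eval X.toPStruct a ∧ b ∈ t.eval X.toPStruct a)
      ((hX.isClosed_eval s).inter (hX.isClosed_eval t))

end TopStruct.IsBoolean

/-- A homeomorphism onto a substructure of a power is an isomorphism if its coordinates are a joint
embedding. -/
theorem PStruct.JointEmbedding.isIsomorphism {X Y : TopStruct S} {I : Type u}
    {U : Set (Y.pow I)} {hU : (Y.pow I).OpClosed U} {F : X → (Y.pow I).sub U hU}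
    (hF : X.toPStruct.JointEmbedding Y.toPStruct fun i x => (F x).1 i) (hh : IsHomeomorph F) :
    X.IsIsomorphism ((Y.pow I).sub U hU) F where
  homeo := hh
  map_op := by
    intro h x
    have hsub := Y.jointEmbedding_sub_pow I U hU
    refine Part.ext fun b => ?_
    obtain ⟨b, rfl⟩ := hh.bijective.2 b
    rw [Part.mem_map_iff]
    constructor
    · exact fun hb => ⟨b, hF.mem_op fun i => (hsub.isHom i).map_op h _ _ hb, rfl⟩
    · rintro ⟨b', hb', e⟩
      rw [← e]
      exact hsub.mem_op fun i => (hF.isHom i).map_op h _ _ hb'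
  map_rel r x := ⟨fun h => hF.rel r x h, fun h i => (hF.isHom i).map_rel r x h⟩

theorem TopStruct.IsIsomorphism.jointEmbedding {X Y : TopStruct S} {I : Type u}
    {U : Set (Y.pow I)} {hU : (Y.pow I).OpClosed U} {F : X → (Y.pow I).sub U hU}
    (hF : X.IsIsomorphism ((Y.pow I).sub U hU) F) :
    X.toPStruct.JointEmbedding Y.toPStruct fun i x => (F x).1 i := by
  have hsub := Y.jointEmbedding_sub_pow I U hU
  refine ⟨fun i => ⟨fun h x y hy => ?_, fun r x hx => ?_⟩, fun x y h => ?_, fun h x hx => ?_,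
    fun r x hx => ?_⟩
  · refine (hsub.isHom i).map_op h (F ∘ x) (F y) ?_
    rw [hF.map_op]
    exact Part.mem_map F hy
  · exact (hsub.isHom i).map_rel r (F ∘ x) ((hF.map_rel r x).2 hx)
  · exact hF.homeo.injective (hsub.injective _ _ h)
  · have := hsub.dom h (F ∘ x) hx
    rw [hF.map_op] at this
    exact this
  · exact (hF.map_rel r x).1 (hsub.rel r (F ∘ x) hx)

end Topology

section DualClass

variable {L : FirstOrder.Language.{v, w}} {M : Type u} [L.Structure M]

instance (𝕄 : AlterEgo L M) : DiscreteTopology 𝕄.str := ⟨rfl⟩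

instance [Finite M] (𝕄 : AlterEgo L M) : Finite 𝕄.str := ‹Finite M›

variable {𝕄 : AlterEgo L M}

instance (I : Type u) : T2Space (𝕄.str.pow I) := inferInstanceAs (T2Space (I → 𝕄.str))

instance (I : Type u) : TotallyDisconnectedSpace (𝕄.str.pow I) :=
  inferInstanceAs (TotallyDisconnectedSpace (I → 𝕄.str))

instance [Finite M] (I : Type u) : CompactSpace (𝕄.str.pow I) :=
  inferInstanceAs (CompactSpace (I → 𝕄.str))

instance (I : Type u) (U : Set (𝕄.str.pow I)) (hU : (𝕄.str.pow I).OpClosed U) :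
    T2Space ((𝕄.str.pow I).sub U hU) := inferInstanceAs (T2Space U)

/-- A compact structure with a non-empty family of continuous maps to `𝕄` that is a joint embedding
belongs to the dual class. -/
theorem AlterEgo.inDualClass_of_jointEmbedding {X : TopStruct 𝕄.sig} [CompactSpace X]
    {I : Type u} [hI : Nonempty I] {f : I → X → 𝕄.str}
    (hf : X.toPStruct.JointEmbedding 𝕄.str.toPStruct f) (hc : ∀ i, Continuous (f i)) :
    𝕄.InDualClass X := by
  let F : X → 𝕄.str.pow I := fun x i => f i x
  have hFc : Continuous F := continuous_pi hc
  have hU : (𝕄.str.pow I).OpClosed (Set.range F) := by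
    intro h x hx y hy
    choose x' hx' using hx
    have hy' : ∀ i, y i ∈ 𝕄.str.op h (f i ∘ x') := fun i => by
      have := ((𝕄.str.jointEmbedding_pow I).isHom i).map_op h x y hy
      rwa [← funext hx'] at this
    have hd := hf.dom h x' fun i => (hy' i).1
    exact ⟨_, funext fun i =>
      Part.mem_unique ((hf.isHom i).map_op h x' _ (Part.get_mem hd)) (hy' i)⟩
  have hinj : Function.Injective F := fun x y h => hf.injective _ _ fun i => congrFun h i
  refine ⟨I, hI, Set.range F, hU, (isCompact_range hFc).isClosed, fun x => ⟨F x, x, rfl⟩,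
    PStruct.JointEmbedding.isIsomorphism hf
      (isHomeomorph_iff_continuous_bijective.2 ⟨hFc.subtype_mk _, ?_, ?_⟩)⟩
  · exact fun x y h => hinj (congrArg Subtype.val h)
  · rintro ⟨_, x, rfl⟩
    exact ⟨x, rfl⟩

theorem AlterEgo.InDualClass.exists_jointEmbedding {X : TopStruct 𝕄.sig} (hX : 𝕄.InDualClass X) :
    ∃ (I : Type u) (_ : Nonempty I) (f : I → X → 𝕄.str),
      X.toPStruct.JointEmbedding 𝕄.str.toPStruct f ∧ ∀ i, Continuous (f i) := by
  obtain ⟨I, hI, U, hU, -, F, hF⟩ := hX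
  refine ⟨I, hI, _, hF.jointEmbedding, fun i => ?_⟩
  have hval : Continuous fun z : (𝕄.str.pow I).sub U hU => (z.1 : I → 𝕄.str) :=
    continuous_subtype_val (X := I → 𝕄.str)
  exact (continuous_apply i).comp (hval.comp hF.homeo.continuous)

/-- Members of the dual class are Boolean models of the universal Horn theory of the alter ego. -/
theorem AlterEgo.InDualClass.inModelClass [Finite M] {X : TopStruct 𝕄.sig}
    (hX : 𝕄.InDualClass X) : 𝕄.InModelClass X := by
  obtain ⟨I, hI, f, hf, hc⟩ := hX.exists_jointEmbedding
  refine ⟨?_, fun σ hσ => hf.uhHolds hσ⟩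
  obtain ⟨J, -, U, hU, hUc, F, hF⟩ := hX
  have hUC : CompactSpace U := isCompact_iff_compactSpace.1 hUc.isCompact
  let e : X ≃ₜ U := hF.homeo.homeomorph
  have hT2 : T2Space X := e.symm.t2Space
  have hcomp : CompactSpace X := e.symm.compactSpace
  have htd : TotallyDisconnectedSpace X := e.symm.totallyDisconnectedSpace
  refine TopStruct.isBoolean_of_isClosed_graph hcomp hT2 htd (fun r => ?_) fun h => ?_
  · have e : X.rel r = ⋂ i, (fun x => f i ∘ x) ⁻¹' 𝕄.str.rel r := by
      ext x
      simp only [Set.mem_iInter]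
      exact ⟨fun hx i => (hf.isHom i).map_rel r x hx, hf.rel r x⟩
    rw [e]
    refine isClosed_iInter fun i => (isClosed_discrete _).preimage ?_
    exact continuous_pi fun j => (hc i).comp (continuous_apply j)
  · have e : {p : (Fin (𝕄.sig.opArity h) → X) × X | p.2 ∈ X.op h p.1} =
        ⋂ i, (fun p : (Fin (𝕄.sig.opArity h) → X) × X => (f i ∘ p.1, f i p.2)) ⁻¹'
          {q : (Fin (𝕄.sig.opArity h) → 𝕄.str) × 𝕄.str | q.2 ∈ 𝕄.str.op h q.1} := by
      ext p
      simp only [Set.mem_iInter]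
      exact ⟨fun hp i => (hf.isHom i).map_op h _ _ hp, fun hp => hf.mem_op hp⟩
    rw [e]
    refine isClosed_iInter fun i => (isClosed_discrete _).preimage ?_
    exact (continuous_pi fun j => (hc i).comp ((continuous_apply j).comp continuous_fst)).prodMk
      ((hc i).comp continuous_snd)

/-- A finite model of the universal Horn theory of a finite alter ego belongs to the dual class:
an atomic formula that fails at an enumeration of the model does not follow, in the alter ego, from
a finite part of the positive diagram that is equivalent to the whole diagram, so it fails under
some homomorphism. -/
theorem AlterEgo.InModelClass.inDualClass_of_finite [Finite M] {X : TopStruct 𝕄.sig} [Finite X]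
    (hX : 𝕄.InModelClass X) : 𝕄.InDualClass X := by
  have := hX.1.hausdorff
  have hdisc : DiscreteTopology X := inferInstance
  obtain ⟨N, ⟨e⟩⟩ := Finite.exists_equiv_fin X
  obtain ⟨Δ, hΔ, hΔ'⟩ := exists_list_holds_iff (N := N) 𝕄.str.toPStruct
    {α | α.toAtom.Holds X.toPStruct e.symm}
  have key : ∀ γ : Option (Atom 𝕄.sig N), (∀ g ∈ γ, ¬ g.Holds X.toPStruct e.symm) →
      ∃ f : {f : X → 𝕄.str // X.toPStruct.IsHom 𝕄.str.toPStruct f},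
        ∀ g ∈ γ, ¬ g.Holds 𝕄.str.toPStruct (f.1 ∘ e.symm) := by
    intro γ hγ
    by_contra! hno
    obtain ⟨g, hg, h⟩ := hX.2 ⟨N, Δ.map HypPure.toAtom, γ⟩ (by
      intro b hb
      have hb' : ∀ α ∈ Δ, α.toAtom.Holds 𝕄.str.toPStruct b :=
        fun α hα => hb _ (List.mem_map_of_mem hα)
      have hbe : (b ∘ e) ∘ e.symm = b := by funext; simp
      obtain ⟨g, hg, h⟩ := hno ⟨b ∘ e, isHom_of_holds e.symm.surjective fun α hα => by
        rw [hbe]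
        exact hΔ' b hb' α hα⟩
      exact ⟨g, hg, hbe ▸ h⟩) e.symm (by
      intro ψ hψ
      obtain ⟨α, hα, rfl⟩ := List.mem_map.1 hψ
      exact hΔ α hα)
    exact hγ g hg h
  have key' : ∀ g : Atom 𝕄.sig N,
      (∀ f : {f : X → 𝕄.str // X.toPStruct.IsHom 𝕄.str.toPStruct f},
        g.Holds 𝕄.str.toPStruct (f.1 ∘ e.symm)) → g.Holds X.toPStruct e.symm := by
    intro g hg
    by_contra hn
    obtain ⟨f, hf⟩ := key (some g) fun g' hg' => by
      obtain rfl := Option.mem_some_iff.1 hg'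
      exact hn
    exact hf g rfl (hg f)
  have hne : Nonempty {f : X → 𝕄.str // X.toPStruct.IsHom 𝕄.str.toPStruct f} := by
    obtain ⟨f, -⟩ := key none fun g hg => by cases hg
    exact ⟨f⟩
  have hee : ∀ {n} (x : Fin n → X), e.symm ∘ e ∘ x = x := fun x => by funext; simp
  refine AlterEgo.inDualClass_of_jointEmbedding
    (f := fun f : {f : X → 𝕄.str // X.toPStruct.IsHom 𝕄.str.toPStruct f} => f.1) ?_
    fun _ => continuous_of_discreteTopology
  refine ⟨fun f => f.2, fun x y h => ?_, fun h x hx => ?_, fun r x hx => ?_⟩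
  · have := Atom.holds_eq_var.1 (key' (.eq (.var (e x)) (.var (e y))) fun f =>
      Atom.holds_eq_var.2 (by simpa using h f))
    simpa using this
  · have := Atom.holds_dom_var.1 (key' (.eq (.app h fun j => .var (e (x j)))
      (.app h fun j => .var (e (x j)))) fun f => Atom.holds_dom_var.2 (by
        have : (f.1 ∘ e.symm) ∘ (e ∘ x) = f.1 ∘ x := by rw [Function.comp_assoc, hee]
        exact (congrArg (fun y => (𝕄.str.op h y).Dom) this).mpr (hx f)))
    rwa [show (e.symm ∘ fun j => e (x j)) = x from hee x] at this
  · have := Atom.holds_rel_var.1 (key' (.rel r fun j => .var (e (x j))) fun f =>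
      Atom.holds_rel_var.2 (by
        have : (f.1 ∘ e.symm) ∘ (e ∘ x) = f.1 ∘ x := by rw [Function.comp_assoc, hee]
        exact (congrArg (· ∈ 𝕄.str.rel r) this).mpr (hx f)))
    rwa [show (e.symm ∘ fun j => e (x j)) = x from hee x] at this

/-! ### The translation of Boolean models -/

variable {𝕄₁ 𝕄₂ : AlterEgo L M} (τ : HatChoice 𝕄₂)

theorem HatChoice.isClosed_interp {X : TopStruct 𝕄₂.sig} (hX : X.IsBoolean) {n : ℕ}
    (r : CompatRel L M n) : IsClosed (τ.interp X.toPStruct r : Set (Fin n → X)) := by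
  have := hX.compact
  refine isClosed_exists (P := fun (a : Fin n → X) (w : Fin (τ.m r) → X) =>
    Fin.append a w ∈ (τ.formula r).solutions X.toPStruct) ?_
  refine (hX.isClosed_solutions (τ.formula r)).preimage
    (f := fun p : (Fin n → X) × (Fin (τ.m r) → X) => Fin.append p.1 p.2) ?_
  refine continuous_pi fun i => Fin.addCases (fun i => ?_) (fun i => ?_) i
  · simp only [Fin.append_left]
    exact (continuous_apply i).comp continuous_fst
  · simp only [Fin.append_right]
    exact (continuous_apply i).comp continuous_snd

theorem HatChoice.isBoolean_translate {X : TopStruct 𝕄₂.sig} (hX : X.IsBoolean)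
    (hXm : X.toPStruct.Models 𝕄₂.str.toPStruct) : (τ.translate 𝕄₁ X).IsBoolean := by
  refine TopStruct.isBoolean_of_isClosed_graph hX.compact hX.hausdorff hX.totallyDisconnected
    (fun r => τ.isClosed_interp hX r.1.2) fun h => ?_
  have e : {p : (Fin h.1.1 → X) × X | p.2 ∈ (τ.translate 𝕄₁ X).op h p.1} =
      (fun p : (Fin h.1.1 → X) × X => (Fin.snoc p.1 p.2 : Fin (h.1.1 + 1) → X)) ⁻¹'
        τ.interp X.toPStruct h.1.2.graph := by
    ext p
    exact τ.mem_translate_op hXm h p.1 p.2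
  have hc : IsClosed {p : (Fin h.1.1 → X) × X | p.2 ∈ (τ.translate 𝕄₁ X).op h p.1} := by
    rw [e]
    exact (τ.isClosed_interp hX _).preimage (continuous_fst.finSnoc continuous_snd)
  exact hc

end DualClass

/-! ### Transfer of dualities -/

section Duality

variable {L : FirstOrder.Language.{v, w}} [L.IsAlgebraic] {M : Type u} [L.Structure M]

/-- The evaluation map is an isomorphism if `X` embeds into a power of `𝕄` by its morphisms to `𝕄`
and every homomorphism from the algebra of these morphisms is an evaluation. -/
theorem AlterEgo.isIsomorphism_evalStr {𝕄 : AlterEgo L M} {X : TopStruct 𝕄.sig} [CompactSpace X]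
    (hE : X.toPStruct.JointEmbedding 𝕄.str.toPStruct fun u : 𝕄.E X => u.1)
    (hsurj : ∀ g : 𝕄.E X →[L] M, ∃ x : X, ∀ u : 𝕄.E X, g u = u.1 x) :
    X.IsIsomorphism (𝕄.D (𝕄.E X)) (𝕄.evalStr X) := by
  refine PStruct.JointEmbedding.isIsomorphism (F := 𝕄.evalStr X) hE ?_
  let F : X → 𝕄.E X → 𝕄.str := fun x u => u.1 x
  have hcont : Continuous F := continuous_pi fun u => TopStruct.IsMorphism.continuous u.2
  have hT2 : T2Space (𝕄.D (𝕄.E X)) := 𝕄.t2Space_D _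
  refine (isHomeomorph_iff_continuous_bijective (Y := 𝕄.D (𝕄.E X))).2
    ⟨hcont.subtype_mk _, ?_, ?_⟩
  · exact fun x y h => hE.injective x y fun u => congrFun (congrArg Subtype.val h) u
  · rintro ⟨_, g, rfl⟩
    obtain ⟨x, hx⟩ := hsurj g
    exact ⟨x, Subtype.ext (funext fun u => (hx u).symm)⟩

theorem AlterEgo.exists_eq_eval_of_isIsomorphism {𝕄 : AlterEgo L M} {X : TopStruct 𝕄.sig}
    (h : X.IsIsomorphism (𝕄.D (𝕄.E X)) (𝕄.evalStr X)) (g : 𝕄.E X →[L] M) :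
    ∃ x : X, ∀ u : 𝕄.E X, g u = u.1 x := by
  obtain ⟨x, hx⟩ := h.homeo.surjective ⟨⇑g, g, rfl⟩
  exact ⟨x, fun u => (congrFun (congrArg Subtype.val hx) u).symm⟩

variable {𝕄₁ 𝕄₂ : AlterEgo L M} (τ : HatChoice 𝕄₂)
include τ

/-- Morphisms from the dual of an algebra to `𝕄₂` preserve all compatible relations, hence are
morphisms to `𝕄₁`. -/
theorem HatChoice.isMorphism_of_D {A : Type u} [L.Structure A] {f : homSet L M A → M}
    (hf : (𝕄₂.D A).IsMorphism 𝕄₂.str f) : (𝕄₁.D A).IsMorphism 𝕄₁.str f := by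
  have hfh : (𝕄₂.D A).toPStruct.IsHom 𝕄₂.str.toPStruct f := ⟨hf.map_op, hf.map_rel⟩
  have hpres : ∀ {n} (r : CompatRel L M n) (x : Fin n → homSet L M A),
      (∀ a, (fun j => (x j).1 a) ∈ r.alg) → f ∘ x ∈ r.alg := by
    intro n r x hx
    refine τ.interp_map hfh r (a := x) ?_
    let p : A →[L] r.alg :=
      { toFun := fun a => ⟨fun j => (x j).1 a, hx a⟩
        map_fun' := by
          intro k F a
          apply Subtype.ext
          funext j
          obtain ⟨g, hg⟩ := (x j).2
          change (x j).1 _ = FirstOrder.Language.Structure.funMap F fun i => (x j).1 (a i)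
          rw [← hg]
          exact g.map_fun F a
        map_rel' := fun s => isEmptyElim s }
    refine ⟨fun j => ⟨fun a => τ.enum r j (p a), (τ.enum r j).comp p, rfl⟩, ?_⟩
    refine (𝕄₂.str.jointEmbedding_sub_pow _ _ _).mem_solutions fun a => ?_
    exact (congrArg (· ∈ (τ.formula r).solutions 𝕄₂.str.toPStruct)
      (comp_append (fun z : homSet L M A => z.1 a) x _)).mpr
        ((τ.append_mem_str r _ _).2 ⟨hx a, fun j => rfl⟩)
  refine ⟨hf.continuous, fun h x y hy => ?_, fun r x hx => hpres r.1.2 x hx⟩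
  refine (h.1.2.snoc_mem_graph _ _).1 ?_
  refine (congrArg (· ∈ h.1.2.graph.alg) (comp_snoc f x y)).mp (hpres h.1.2.graph _ fun a => ?_)
  have := ((𝕄₁.str.jointEmbedding_sub_pow A _ (homSet_opClosed 𝕄₁ A)).isHom a).map_op h x y hy
  refine (congrArg (· ∈ h.1.2.graph.alg)
    (comp_snoc (fun z : homSet L M A => z.1 a) x y)).mpr ?_
  exact (h.1.2.snoc_mem_graph _ _).2 this

theorem HatChoice.evalAlg_bijective {A : Type u} [L.Structure A]
    (h : Function.Bijective (𝕄₁.evalAlg A)) : Function.Bijective (𝕄₂.evalAlg A) := by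
  constructor
  · intro a b hab
    exact h.1 (Subtype.ext (congrArg Subtype.val hab :))
  · rintro ⟨f, hf⟩
    obtain ⟨a, ha⟩ := h.2 ⟨f, τ.isMorphism_of_D hf⟩
    exact ⟨a, Subtype.ext (congrArg Subtype.val ha :)⟩

/-- If the translation of a Boolean model `X` is isomorphic to its double dual over `𝕄₁`, then `X`
is isomorphic to its double dual over `𝕄₂`. -/
theorem HatChoice.isIsomorphism_of_translate [Finite M] (op : 𝕄₂.CondOP)
    (hd : 𝕄₁.DualisesFinite) {X : TopStruct 𝕄₂.sig} (hX : 𝕄₂.InModelClass X)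
    (hiso : (τ.translate 𝕄₁ X).IsIsomorphism (𝕄₁.D (𝕄₁.E (τ.translate 𝕄₁ X)))
      (𝕄₁.evalStr (τ.translate 𝕄₁ X))) :
    X.IsIsomorphism (𝕄₂.D (𝕄₂.E X)) (𝕄₂.evalStr X) := by
  have := hX.1.compact
  let P : L.Substructure (X → M) → Prop := fun E =>
    ((τ.translate 𝕄₁ X).toPStruct.JointEmbedding 𝕄₁.str.toPStruct fun u : E => u.1) ∧
      ∀ g : E →[L] M, ∃ x : X, ∀ u : E, g u = u.1 x
  have h1 : P (𝕄₁.E (τ.translate 𝕄₁ X)) :=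
    ⟨TopStruct.IsIsomorphism.jointEmbedding hiso,
      AlterEgo.exists_eq_eval_of_isIsomorphism hiso⟩
  rw [τ.E_translate op hd hX.2] at h1
  exact AlterEgo.isIsomorphism_evalStr (τ.jointEmbedding_of_translate op hd hX.2 h1.1 h1.2) h1.2

end Duality

end NatDual

theorem mainTheorem1 {L : FirstOrder.Language.{v, w}} [L.IsAlgebraic]
    {M : Type u} [L.Structure M] [Finite M] [Nonempty M]
    (𝕄₁ 𝕄₂ : NatDual.AlterEgo L M)
    (hm : 𝕄₂.CondHM) (op : 𝕄₂.CondOP)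
    (Γ : Set (NatDual.PureUH 𝕄₁.sig)) (hΓ : NatDual.IsPureBasis Γ 𝕄₁.str.toPStruct)
    (τ : NatDual.HatChoice 𝕄₂) (ax : NatDual.CondAX Γ τ) :
    (𝕄₁.FullyDualisesFinite → 𝕄₂.FullyDualisesFinite) ∧
    (𝕄₁.Standard ∧ 𝕄₁.FullyDualises → 𝕄₂.Standard ∧ 𝕄₂.FullyDualises) := by
  have htr : ∀ X : NatDual.TopStruct 𝕄₂.sig, 𝕄₂.InModelClass X →
      𝕄₁.InModelClass (τ.translate 𝕄₁ X) := fun X hX =>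
    ⟨τ.isBoolean_translate hX.1 hX.2, τ.translate_models op hΓ ax hX.2⟩
  constructor
  · rintro ⟨hA, hS⟩
    refine ⟨fun A _ hfin hq => τ.evalAlg_bijective (hA A hfin hq), fun X hfin hX => ?_⟩
    have hfin' : Finite (τ.translate 𝕄₁ X) := hfin
    exact τ.isIsomorphism_of_translate op hA hX.inModelClass
      (hS _ hfin' (htr X hX.inModelClass).inDualClass_of_finite)
  · rintro ⟨hst, hA, hS⟩
    have hd : 𝕄₁.DualisesFinite := fun A _ _ hq => hA A hq
    have hiso : ∀ X : NatDual.TopStruct 𝕄₂.sig, 𝕄₂.InModelClass X →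
        X.IsIsomorphism (𝕄₂.D (𝕄₂.E X)) (𝕄₂.evalStr X) := fun X hX =>
      τ.isIsomorphism_of_translate op hd hX (hS _ ((hst _).2 (htr X hX)))
    refine ⟨fun X => ⟨fun hX => hX.inModelClass, fun hX => ?_⟩,
      fun A _ hq => τ.evalAlg_bijective (hA A hq), fun X hX => hiso X hX.inModelClass⟩
    obtain ⟨I, ⟨i⟩, f, hf, hc⟩ := ((hst _).2 (htr X hX)).exists_jointEmbedding
    -- The power of `𝕄₂` has to be non-zero: the dual class of `𝕄₁` provides a morphism.
    have hi : f i ∈ 𝕄₁.E (τ.translate 𝕄₁ X) := ⟨hc i, (hf.isHom i).map_op, (hf.isHom i).map_rel⟩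
    rw [τ.E_translate op hd hX.2] at hi
    have : Nonempty (𝕄₂.E X) := ⟨⟨f i, hi⟩⟩
    have := hX.1.compact
    exact NatDual.AlterEgo.inDualClass_of_jointEmbedding (hiso X hX).jointEmbedding fun u =>
      NatDual.TopStruct.IsMorphism.continuous u.2
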